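/- **Programs.** Fix a set of symbolic constants and a set of program variables. Program terms are built from numerals $\overline n$ ($n\in\mathbb Z$), symbolic constants, program variables, and the symbols $\mathit{inf}$, $\mathit{sup}$ using the operation names $+,-,\times,/,\backslash,..$. The precomputed terms are the numerals, symbolic constants, $\mathit{inf}$ and $\mathit{sup}$; they carry a fixed total order with least element $\mathit{inf}$, greatest element $\mathit{sup}$, $\overline m<\overline n$ iff $m<n$, and $\overline n<c$ for every symbolic constant $c$. A rule is $H\leftarrow B_1\wedge\dots\wedge B_n$ ($n\ge0$), where each $B_j$ is an atom $p(t_1,\dots,t_k)$ preceded by at most two occurrences of *not*, or a comparison $t_1\prec t_2$ with $\prec$ one of $=,\neq,<,>,\le,\ge$, and $H$ is an atom $p(\mathbf t)$, or $\{p(\mathbf t)\}$, or empty. A predicate symbol is a pair $p/n$. It occurs in a rule if the rule contains an atom $p(t_1,\dots,t_n)$. **Stable models.** The set $[t]$ of values of a ground term $t$ is $\{t\}$ if $t$ is precomputed. Otherwise $[t_1\,op\,t_2]$ is the set of all $\overline{m\,op\,n}$ with $\overline m\in[t_1]$, $\overline n\in[t_2]$ for $op\in\{+,-,\times\}$; of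 all $\overline{\lfloor m/n\rfloor}$, resp. $\overline{m-n\lfloor m/n\rfloor}$, with also $n\ne0$, for $/$, resp. $\backslash$; and of all $\overline k$ with $m\le k\le n$, for $..$. For a ground rule $R$, $\tau R$ is the propositional formula $\tau B_1\wedge\dots\wedge\tau B_n\to\tau H$. Here $\tau(p(\mathbf t))$, $\tau(\mathit{not}\ p(\mathbf t))$, $\tau(\mathit{not}\ \mathit{not}\ p(\mathbf t))$ in the body are $\bigvee_{\mathbf r}p(\mathbf r)$, $\bigvee_{\mathbf r}\neg p(\mathbf r)$, $\bigvee_{\mathbf r}\neg\neg p(\mathbf r)$, where $\mathbf r$ ranges over $[t_1]\times\dots\times[t_k]$; $\tau(t_1\prec t_2)$ is $\top$ if $r_1\prec r_2$ for some $r_1\in[t_1]$, $r_2\in[t_2]$, and $\bot$ otherwise; and $\tau H$ is $\bigwedge_{\mathbf r}p(\mathbf r)$, $\bigwedge_{\mathbf r}(p(\mathbf r)\vee\neg p(\mathbf r))$ or $\bot$ for $H$ of the form $p(\mathbf t)$, $\{p(\mathbf t)\}$ or empty. For a set of rules, $\tau$ gives the set of all $\tau R$, where $R$ ranges over the instances of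 the rules (precomputed terms substituted for variables). A set $\mathcal J$ of precomputed atoms is a stable model of a set of rules if it is minimal, with respect to inclusion, among the sets that satisfy all reducts $F^{\mathcal J}$ of formulas $F$ from its $\tau$-translation ($F^{\mathcal J}$ is $F$ with all maximal subformulas not satisfied by $\mathcal J$ replaced by $\bot$). **IO-programs.** An io-program is $\Omega=(\Pi,\mathit{PH},\mathit{In},\mathit{Out})$, where $\Pi$ is a finite set of rules, $\mathit{PH}$ a finite set of symbolic constants (placeholders), $\mathit{In}$ a finite set of predicate symbols not occurring in heads of rules of $\Pi$, and $\mathit{Out}$ a finite set of predicate symbols disjoint from $\mathit{In}$. The members of $\mathit{In}\cup\mathit{Out}$ are public; the other predicate symbols occurring in $\Pi$ are private. An input is a pair $(\mathbf v,\mathbf i)$, where $\mathbf v$ maps placeholders to precomputed terms that are not placeholders, and $\mathbf i$ is a set of precomputed atoms without placeholders whose predicate symbols are in $\mathit{In}$. The program $\Omega(\mathbf v,\mathbf i)$ consists of the rules of $\Pi$ with every placeholder $c$ (occurring as a term) replaced by $\mathbf v(c)$, and of the atoms in $\mathbf i$ as facts. An io-model of $\Omega$ for $(\mathbf v,\mathbf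 i)$ is the set of all public atoms of some stable model of $\Omega(\mathbf v,\mathbf i)$. For a set $\mathcal I$ of public atoms, $\mathcal I^{in}$ is the set of its members whose predicate symbols are in $\mathit{In}$. **The first-order translation.** Two-sorted formulas have program variables and integer variables (the sort integer is a subsort of the first sort), all precomputed terms as constants (numerals are of sort integer), $+,-,\times$ on the sort integer, and predicate symbols and comparison symbols. The formula $val_t(Z)$ is $Z=t$ if $t$ is a precomputed term or a program variable. For $t=t_1\,op\,t_2$, with fresh integer variables $I,J,K,Q,R$, it is - $\exists IJ(Z=I\,op\,J\wedge val_{t_1}(I)\wedge val_{t_2}(J))$ if $op\in\{+,-,\times\}$; - $\exists IJQR(I=J\times Q+R\wedge val_{t_1}(I)\wedge val_{t_2}(J)\wedge J\ne0\wedge((0\le R\wedge R<J)\vee(J<R\wedge R\le0))\wedge Z=Q)$ if $op$ is $/$, and the same with $Z=R$ in place of $Z=Q$ if $op$ is $\backslash$; - $\exists IJK(val_{t_1}(I)\wedge val_{t_2}(J)\wedge I\le K\wedge K\le J\wedge Z=K)$ if $op$ is $..$. Write $val_{\mathbf t}(\mathbf Z)$ for $val_{t_1}(Z_1)\wedge\dots\wedge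 val_{t_k}(Z_k)$, where the $Z_j$ are fresh program variables. $\tau^B$ maps $p(\mathbf t)$, $\mathit{not}\ p(\mathbf t)$, $\mathit{not}\ \mathit{not}\ p(\mathbf t)$ and $t_1\prec t_2$ to $\exists\mathbf Z(val_{\mathbf t}(\mathbf Z)\wedge F)$ with $F$ equal to $p(\mathbf Z)$, $\neg p(\mathbf Z)$, $\neg\neg p(\mathbf Z)$ and $Z_1\prec Z_2$, respectively. $\tau^*\Pi$ is the set of the universal closures of $\tau^B(B_1)\wedge\dots\wedge\tau^B(B_n)\to H^*$ for the rules of $\Pi$, where $H^*$ is $\forall\mathbf Z(val_{\mathbf t}(\mathbf Z)\to p(\mathbf Z))$, $\forall\mathbf Z(val_{\mathbf t}(\mathbf Z)\to p(\mathbf Z)\vee\neg p(\mathbf Z))$ or $\bot$ for the heads $p(\mathbf t)$, $\{p(\mathbf t)\}$ and empty. **Stable models with private symbols.** For a list $\mathbf p$ of predicate symbols and a tuple $\mathbf u$ of predicate variables of the same arities, $F^*(\mathbf u)$ is obtained from a first-order formula $F$ by replacing the members of $\mathbf p$ by the corresponding members of $\mathbf u$ and, recursively, $(F\to G)^*=(F^*\to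 G^*)\wedge(F\to G)$, while $*$ commutes with $\wedge,\vee,\forall,\exists$. $\mathrm{SM}_{\mathbf p}[F]$ is $F\wedge\neg\exists\mathbf u((\mathbf u<\mathbf p)\wedge F^*(\mathbf u))$, where $\mathbf u<\mathbf p$ means that each $u_j$ implies $p_j$, but not conversely for all $j$. The $\mathbf p$-stable models with private symbols $\mathbf h$ of a finite set $\Gamma$ of sentences are the models of $\exists\mathbf H\,(\mathrm{SM}_{\mathbf p}[F])^{\mathbf h}_{\mathbf H}$, where $F$ is the conjunction of $\Gamma$ and the constants $\mathbf h$ are replaced by predicate variables $\mathbf H$. **The interpretation $\mathcal I^{\mathbf v}$.** For a set $\mathcal I$ of precomputed public atoms and a valuation $\mathbf v$, the universe of the first sort of $\mathcal I^{\mathbf v}$ is the set of all precomputed terms, and the universe of the sort integer is the set of all numerals. A placeholder $c$ is interpreted as $\mathbf v(c)$ and every other precomputed term as itself. $+,-,\times$ and the comparison symbols have their usual meaning on these universes. A predicate symbol $p/n$ is interpreted as the set of tuples $\mathbf r$ of precomputed terms with $p(\mathbf r)\in\mathcal I$. **Main Lemma for IO-Programs.** Let $\Omega=(\Pi,\mathit{PH},\mathit{In},\mathit{Out})$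 be an io-program, let $\mathbf p$ be the list of all predicate symbols occurring in $\Pi$ other than the input symbols, and let $\mathbf h$ be the list of all private symbols of $\Omega$. Let $(\mathbf v,\mathbf i)$ be an input for $\Omega$, and let $\mathcal I$ be a set of precomputed public atoms such that every output symbol with which an atom of $\mathcal I$ begins occurs in $\Pi$. Then $\mathcal I$ is an io-model of $\Omega$ for $(\mathbf v,\mathbf i)$ if and only if $\mathcal I^{\mathbf v}$ is a $\mathbf p$-stable model of $\tau^*\Pi$ with private symbols $\mathbf h$ and $\mathcal I^{in}=\mathbf i$. -/

import Mathlib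

namespace AspIO

/-! ### Syntax of programs -/

/-- Precomputed terms over the set `Sym` of symbolic constants; numerals are indexed by integers. -/
inductive PTerm (Sym : Type*) where
  | inf : PTerm Sym
  | num : ℤ → PTerm Sym
  | sym : Sym → PTerm Sym
  | sup : PTerm Sym

/-- The chosen total order on precomputed terms. -/
class PrecomputedOrder (Sym : Type*) extends LinearOrder (PTerm Sym) where
  inf_le : ∀ r : PTerm Sym, PTerm.inf ≤ r
  le_sup : ∀ r : PTerm Sym, r ≤ PTerm.sup
  num_lt_num : ∀ m n : ℤ, (PTerm.num m : PTerm Sym) < PTerm.num n ↔ m < n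
  num_lt_sym : ∀ (n : ℤ) (c : Sym), (PTerm.num n : PTerm Sym) < PTerm.sym c

inductive OpName where
  | add | sub | mul | div | mod | interval

/-- Program terms with program variables from `Var`; ground terms are `Term Sym Empty`. -/
inductive Term (Sym Var : Type*) where
  | inf : Term Sym Var
  | num : ℤ → Term Sym Var
  | sym : Sym → Term Sym Var
  | sup : Term Sym Var
  | var : Var → Term Sym Var
  | op : OpName → Term Sym Var → Term Sym Var → Term Sym Var

/-- The comparison symbols other than equality. -/
inductive Ineq where
  | ne | lt | gt | le | ge

/-- The comparison symbols. -/
inductive CompSym where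
  | eq : CompSym
  | ineq : Ineq → CompSym

/-- A predicate symbol `p/n`. -/
structure PredSym (Sym : Type*) where
  name : Sym
  arity : ℕ

/-- Precomputed atoms `p(r₁, …, rₙ)`. -/
abbrev PAtom (Sym : Type*) := Σ p : PredSym Sym, (Fin p.arity → PTerm Sym)

/-- Atoms `p(t₁, …, tₙ)`. -/
structure Atom (Sym Var : Type*) where
  pred : PredSym Sym
  args : Fin pred.arity → Term Sym Var

/-- Members of bodies: literals (an atom, possibly preceded by one or two occurrences of `not`)
and comparisons. -/
inductive BodyElt (Sym Var : Type*) where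
  | pos : Atom Sym Var → BodyElt Sym Var
  | neg : Atom Sym Var → BodyElt Sym Var
  | negneg : Atom Sym Var → BodyElt Sym Var
  | comp : CompSym → Term Sym Var → Term Sym Var → BodyElt Sym Var

/-- Heads of basic rules, of choice rules, and of constraints. -/
inductive Head (Sym Var : Type*) where
  | basic : Atom Sym Var → Head Sym Var
  | choice : Atom Sym Var → Head Sym Var
  | empty : Head Sym Var

structure Rule (Sym Var : Type*) where
  head : Head Sym Var
  body : List (BodyElt Sym Var)

section Expressions

variable {Sym Var Var' : Type*}

/-- A precomputed term as a program term. -/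
def PTerm.toTerm : PTerm Sym → Term Sym Var
  | .inf => .inf
  | .num n => .num n
  | .sym c => .sym c
  | .sup => .sup

/-- Simultaneous replacement of the symbolic constants (occurring as terms) and of the
variables of a term. -/
def Term.replace (f : Sym → Term Sym Var') (s : Var → Term Sym Var') :
    Term Sym Var → Term Sym Var'
  | .inf => .inf
  | .num n => .num n
  | .sym c => f c
  | .sup => .sup
  | .var x => s x
  | .op o t₁ t₂ => .op o (t₁.replace f s) (t₂.replace f s)

def Atom.replace (f : Sym → Term Sym Var') (s : Var → Term Sym Var') (a : Atom Sym Var) :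
    Atom Sym Var' :=
  ⟨a.pred, fun i => (a.args i).replace f s⟩

def BodyElt.replace (f : Sym → Term Sym Var') (s : Var → Term Sym Var') :
    BodyElt Sym Var → BodyElt Sym Var'
  | .pos a => .pos (a.replace f s)
  | .neg a => .neg (a.replace f s)
  | .negneg a => .negneg (a.replace f s)
  | .comp c t₁ t₂ => .comp c (t₁.replace f s) (t₂.replace f s)

def Head.replace (f : Sym → Term Sym Var') (s : Var → Term Sym Var') :
    Head Sym Var → Head Sym Var'
  | .basic a => .basic (a.replace f s)
  | .choice a => .choice (a.replace f s)
  | .empty => .empty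

def Rule.replace (f : Sym → Term Sym Var') (s : Var → Term Sym Var') (R : Rule Sym Var) :
    Rule Sym Var' :=
  ⟨R.head.replace f s, R.body.map (BodyElt.replace f s)⟩

/-- The instance of a rule obtained by substituting precomputed terms for its variables. -/
def Rule.inst (s : Var → PTerm Sym) (R : Rule Sym Var) : Rule Sym Empty :=
  R.replace .sym (fun x => (s x).toTerm)

def Term.vars : Term Sym Var → List Var
  | .var x => [x]
  | .op _ t₁ t₂ => t₁.vars ++ t₂.vars
  | _ => []

def Atom.vars (a : Atom Sym Var) : List Var :=
  (List.finRange a.pred.arity).flatMap fun i => (a.args i).vars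

def BodyElt.vars : BodyElt Sym Var → List Var
  | .pos a => a.vars
  | .neg a => a.vars
  | .negneg a => a.vars
  | .comp _ t₁ t₂ => t₁.vars ++ t₂.vars

def Head.vars : Head Sym Var → List Var
  | .basic a => a.vars
  | .choice a => a.vars
  | .empty => []

/-- The variables that occur in a rule (possibly with repetitions). -/
def Rule.vars (R : Rule Sym Var) : List Var :=
  R.head.vars ++ R.body.flatMap BodyElt.vars

def Head.preds : Head Sym Var → List (PredSym Sym)
  | .basic a => [a.pred]
  | .choice a => [a.pred]
  | .empty => []

def BodyElt.preds : BodyElt Sym Var → List (PredSym Sym)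
  | .pos a => [a.pred]
  | .neg a => [a.pred]
  | .negneg a => [a.pred]
  | .comp _ _ _ => []

/-- The predicate symbols that occur in a rule. -/
def Rule.preds (R : Rule Sym Var) : List (PredSym Sym) :=
  R.head.preds ++ R.body.flatMap BodyElt.preds

end Expressions

/-! ### Propositional formulas and their stable models -/

inductive PForm (A : Type*) where
  | bot : PForm A
  | atom : A → PForm A
  | and : PForm A → PForm A → PForm A
  | or : PForm A → PForm A → PForm A
  | imp : PForm A → PForm A → PForm A

namespace PForm

variable {A : Type*}

def neg (F : PForm A) : PForm A := .imp F .bot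

def top : PForm A := .imp .bot .bot

def conj : List (PForm A) → PForm A
  | [] => top
  | F :: l => .and F (conj l)

def disj : List (PForm A) → PForm A
  | [] => .bot
  | F :: l => .or F (disj l)

/-- Satisfaction by a set of atoms. -/
def Sat (X : Set A) : PForm A → Prop
  | .bot => False
  | .atom a => a ∈ X
  | .and F G => F.Sat X ∧ G.Sat X
  | .or F G => F.Sat X ∨ G.Sat X
  | .imp F G => F.Sat X → G.Sat X

open Classical in
/-- The reduct of a formula relative to `X`: maximal subformulas not satisfied by `X` are
replaced by `⊥`. -/
noncomputable def reduct (X : Set A) : PForm A → PForm A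
  | .bot => .bot
  | .atom a => if a ∈ X then .atom a else .bot
  | .and F G => if (PForm.and F G).Sat X then .and (F.reduct X) (G.reduct X) else .bot
  | .or F G => if (PForm.or F G).Sat X then .or (F.reduct X) (G.reduct X) else .bot
  | .imp F G => if (PForm.imp F G).Sat X then .imp (F.reduct X) (G.reduct X) else .bot

/-- `X` is a stable model of `Γ`: it is minimal, with respect to set inclusion, among the sets
that satisfy the reducts relative to `X` of all members of `Γ`. -/
def IsStableModel (Γ : Set (PForm A)) (X : Set A) : Prop :=
  Minimal (fun Y : Set A => ∀ F ∈ Γ, (F.reduct X).Sat Y) X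

end PForm

/-! ### The translation `τ` and the stable models of a program -/

section Tau

variable {Sym Var : Type*}

open Classical in
/-- The values of `(r₁ op r₂)` for precomputed `r₁`, `r₂`. Division rounds down. -/
noncomputable def opValues : OpName → PTerm Sym → PTerm Sym → Finset (PTerm Sym)
  | .add, .num m, .num n => {.num (m + n)}
  | .sub, .num m, .num n => {.num (m - n)}
  | .mul, .num m, .num n => {.num (m * n)}
  | .div, .num m, .num n => if n = 0 then ∅ else {.num (Int.fdiv m n)}
  | .mod, .num m, .num n => if n = 0 then ∅ else {.num (m - n * Int.fdiv m n)}
  | .interval, .num m, .num n => (Finset.Icc m n).image .num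
  | _, _, _ => ∅

open Classical in
/-- The set `[t]` of values of a ground term. -/
noncomputable def Term.values : Term Sym Empty → Finset (PTerm Sym)
  | .inf => {.inf}
  | .num n => {.num n}
  | .sym c => {.sym c}
  | .sup => {.sup}
  | .var x => x.elim
  | .op o t₁ t₂ => t₁.values.biUnion fun r₁ => t₂.values.biUnion fun r₂ => opValues o r₁ r₂

/-- The set of values `[t₁, …, tₙ]` of the tuple of arguments of a ground atom. -/
noncomputable def Atom.values (a : Atom Sym Empty) : Finset (Fin a.pred.arity → PTerm Sym) :=
  Fintype.piFinset fun i => (a.args i).values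

def Ineq.Holds {α : Type*} [LinearOrder α] : Ineq → α → α → Prop
  | .ne, r, s => r ≠ s
  | .lt, r, s => r < s
  | .gt, r, s => r > s
  | .le, r, s => r ≤ s
  | .ge, r, s => r ≥ s

def CompSym.Holds {α : Type*} [LinearOrder α] : CompSym → α → α → Prop
  | .eq, r, s => r = s
  | .ineq c, r, s => c.Holds r s

variable [PrecomputedOrder Sym]

open Classical in
noncomputable def tauBody : BodyElt Sym Empty → PForm (PAtom Sym)
  | .pos a => .disj (a.values.toList.map fun r => .atom ⟨a.pred, r⟩)
  | .neg a => .disj (a.values.toList.map fun r => .neg (.atom ⟨a.pred, r⟩))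
  | .negneg a => .disj (a.values.toList.map fun r => .neg (.neg (.atom ⟨a.pred, r⟩)))
  | .comp c t₁ t₂ =>
      if ∃ r₁ ∈ t₁.values, ∃ r₂ ∈ t₂.values, c.Holds r₁ r₂ then .top else .bot

noncomputable def tauHead : Head Sym Empty → PForm (PAtom Sym)
  | .basic a => .conj (a.values.toList.map fun r => .atom ⟨a.pred, r⟩)
  | .choice a =>
      .conj (a.values.toList.map fun r => .or (.atom ⟨a.pred, r⟩) (.neg (.atom ⟨a.pred, r⟩)))
  | .empty => .bot

/-- `τ` for ground rules. -/
noncomputable def tauRule (R : Rule Sym Empty) : PForm (PAtom Sym) :=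
  .imp (.conj (R.body.map tauBody)) (tauHead R.head)

/-- `τ` for sets of rules: all formulas that correspond to instances of the rules. -/
def tau (P : Set (Rule Sym Var)) : Set (PForm (PAtom Sym)) :=
  {F | ∃ R ∈ P, ∃ s : Var → PTerm Sym, F = tauRule (R.inst s)}

/-- Stable models of a set of rules. -/
def IsStableModelOf (P : Set (Rule Sym Var)) (J : Set (PAtom Sym)) : Prop :=
  PForm.IsStableModel (tau P) J

end Tau

/-! ### Two-sorted formulas -/

/-- Object variables of the first sort: the program variables of rules, and additional ones
`Z₀, Z₁, …` that do not occur in rules. -/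
inductive GVar (Var : Type*) where
  | prog : Var → GVar Var
  | fresh : ℕ → GVar Var

/-- Terms of the sort integer; integer variables are `N₀, N₁, …`. -/
inductive ITerm where
  | num : ℤ → ITerm
  | var : ℕ → ITerm
  | add : ITerm → ITerm → ITerm
  | sub : ITerm → ITerm → ITerm
  | mul : ITerm → ITerm → ITerm

/-- Terms of the first sort, of which the sort integer is a subsort. -/
inductive GTerm (Sym Var : Type*) where
  | inf : GTerm Sym Var
  | sym : Sym → GTerm Sym Var
  | sup : GTerm Sym Var
  | var : GVar Var → GTerm Sym Var
  | int : ITerm → GTerm Sym Var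

/-- Predicate variables. For every predicate symbol `p` there are two: `small p`, used for the
tuple `u` in the definition of the operator `SM`, and `big p`, used for the tuple `H` that
replaces private symbols. -/
inductive PredVar (Sym : Type*) where
  | small : PredSym Sym → PredVar Sym
  | big : PredSym Sym → PredVar Sym

def PredVar.arity {Sym : Type*} : PredVar Sym → ℕ
  | .small p => p.arity
  | .big p => p.arity

/-- Formulas with individual quantifiers. First-order formulas are those without predicate
variables. -/
inductive Formula (Sym Var : Type*) where
  | bot : Formula Sym Var
  | pred : (p : PredSym Sym) → (Fin p.arity → GTerm Sym Var) → Formula Sym Var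
  | pvar : (x : PredVar Sym) → (Fin x.arity → GTerm Sym Var) → Formula Sym Var
  | eq : GTerm Sym Var → GTerm Sym Var → Formula Sym Var
  | ineq : Ineq → GTerm Sym Var → GTerm Sym Var → Formula Sym Var
  | and : Formula Sym Var → Formula Sym Var → Formula Sym Var
  | or : Formula Sym Var → Formula Sym Var → Formula Sym Var
  | imp : Formula Sym Var → Formula Sym Var → Formula Sym Var
  | allG : GVar Var → Formula Sym Var → Formula Sym Var
  | exG : GVar Var → Formula Sym Var → Formula Sym Var
  | allI : ℕ → Formula Sym Var → Formula Sym Var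
  | exI : ℕ → Formula Sym Var → Formula Sym Var

/-- Second-order formulas (as far as they are needed for the operator `SM`). -/
inductive SOFormula (Sym Var : Type*) where
  | fo : Formula Sym Var → SOFormula Sym Var
  | neg : SOFormula Sym Var → SOFormula Sym Var
  | and : SOFormula Sym Var → SOFormula Sym Var → SOFormula Sym Var
  | exP : PredVar Sym → SOFormula Sym Var → SOFormula Sym Var

/-- Interpretations with the universe `D` of the first sort and the universe `N` of the sort
integer, which `incl` identifies with a subset of `D`. -/
structure Interp (Sym D N : Type*) where
  incl : N → D
  incl_injective : Function.Injective incl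
  inf : D
  num : ℤ → N
  sym : Sym → D
  sup : D
  add : N → N → N
  sub : N → N → N
  mul : N → N → N
  ineq : Ineq → D → D → Prop
  pred : (p : PredSym Sym) → (Fin p.arity → D) → Prop

section Semantics

variable {Sym Var D N : Type*}

def ITerm.eval (M : Interp Sym D N) (k : ℕ → N) : ITerm → N
  | .num n => M.num n
  | .var i => k i
  | .add t₁ t₂ => M.add (t₁.eval M k) (t₂.eval M k)
  | .sub t₁ t₂ => M.sub (t₁.eval M k) (t₂.eval M k)
  | .mul t₁ t₂ => M.mul (t₁.eval M k) (t₂.eval M k)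

def GTerm.eval (M : Interp Sym D N) (g : GVar Var → D) (k : ℕ → N) : GTerm Sym Var → D
  | .inf => M.inf
  | .sym c => M.sym c
  | .sup => M.sup
  | .var x => g x
  | .int t => M.incl (t.eval M k)

open Classical in
/-- Satisfaction, relative to values `ρ`, `g`, `k` of predicate variables, variables of the
first sort, and integer variables. -/
def Formula.Sat (M : Interp Sym D N) (ρ : (x : PredVar Sym) → (Fin x.arity → D) → Prop) :
    (GVar Var → D) → (ℕ → N) → Formula Sym Var → Prop
  | _, _, .bot => False
  | g, k, .pred p t => M.pred p fun i => (t i).eval M g k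
  | g, k, .pvar x t => ρ x fun i => (t i).eval M g k
  | g, k, .eq t₁ t₂ => t₁.eval M g k = t₂.eval M g k
  | g, k, .ineq c t₁ t₂ => M.ineq c (t₁.eval M g k) (t₂.eval M g k)
  | g, k, .and F G => F.Sat M ρ g k ∧ G.Sat M ρ g k
  | g, k, .or F G => F.Sat M ρ g k ∨ G.Sat M ρ g k
  | g, k, .imp F G => F.Sat M ρ g k → G.Sat M ρ g k
  | g, k, .allG x F => ∀ d : D, F.Sat M ρ (Function.update g x d) k
  | g, k, .exG x F => ∃ d : D, F.Sat M ρ (Function.update g x d) k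
  | g, k, .allI i F => ∀ n : N, F.Sat M ρ g (Function.update k i n)
  | g, k, .exI i F => ∃ n : N, F.Sat M ρ g (Function.update k i n)

open Classical in
def SOFormula.Sat (M : Interp Sym D N) (g : GVar Var → D) (k : ℕ → N) :
    ((x : PredVar Sym) → (Fin x.arity → D) → Prop) → SOFormula Sym Var → Prop
  | ρ, .fo F => F.Sat M ρ g k
  | ρ, .neg F => ¬ F.Sat M g k ρ
  | ρ, .and F G => F.Sat M g k ρ ∧ G.Sat M g k ρ
  | ρ, .exP x F => ∃ r : (Fin x.arity → D) → Prop, F.Sat M g k (Function.update ρ x r)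

/-- `M` is a model of the sentence `F`. -/
def SOFormula.IsModel (F : SOFormula Sym Var) (M : Interp Sym D N) : Prop :=
  ∀ (ρ : (x : PredVar Sym) → (Fin x.arity → D) → Prop) (g : GVar Var → D) (k : ℕ → N),
    F.Sat M g k ρ

end Semantics

/-! ### The operator `SM` and stable models with private symbols -/

section SM

variable {Sym Var : Type*}

namespace Formula

def top : Formula Sym Var := .imp .bot .bot

def neg (F : Formula Sym Var) : Formula Sym Var := .imp F .bot

def conj : List (Formula Sym Var) → Formula Sym Var
  | [] => top
  | F :: l => .and F (conj l)

def allGs (l : List (GVar Var)) (F : Formula Sym Var) : Formula Sym Var := l.foldr .allG F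

def exGs (l : List (GVar Var)) (F : Formula Sym Var) : Formula Sym Var := l.foldr .exG F

def exIs (l : List ℕ) (F : Formula Sym Var) : Formula Sym Var := l.foldr .exI F

/-- The list `Z₁, …, Zₙ` of variables. -/
def freshVars (n : ℕ) : List (GVar Var) := (List.range n).map .fresh

/-- `u ≤ p`: the conjunction of `∀ x₁ … xₙ (uᵢ(x₁, …, xₙ) → pᵢ(x₁, …, xₙ))`. -/
def smallLe (p : List (PredSym Sym)) : Formula Sym Var :=
  conj (p.map fun q => allGs (freshVars q.arity)
    (.imp (.pvar (.small q) fun i => .var (.fresh i.val)) (.pred q fun i => .var (.fresh i.val))))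

/-- `p ≤ u`. -/
def leSmall (p : List (PredSym Sym)) : Formula Sym Var :=
  conj (p.map fun q => allGs (freshVars q.arity)
    (.imp (.pred q fun i => .var (.fresh i.val)) (.pvar (.small q) fun i => .var (.fresh i.val))))

/-- `u < p`. -/
def smallLt (p : List (PredSym Sym)) : Formula Sym Var :=
  .and (smallLe p) (neg (leSmall p))

open Classical in
/-- The formula `F*(u)`, where the tuple `u` of predicate variables corresponds to the list `p`
of intensional predicate symbols. -/
noncomputable def star (p : List (PredSym Sym)) : Formula Sym Var → Formula Sym Var
  | .bot => .bot
  | .pred q t => if q ∈ p then .pvar (.small q) t else .pred q t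
  | .pvar x t => .pvar x t
  | .eq t₁ t₂ => .eq t₁ t₂
  | .ineq c t₁ t₂ => .ineq c t₁ t₂
  | .and F G => .and (F.star p) (G.star p)
  | .or F G => .or (F.star p) (G.star p)
  | .imp F G => .and (.imp (F.star p) (G.star p)) (.imp F G)
  | .allG x F => .allG x (F.star p)
  | .exG x F => .exG x (F.star p)
  | .allI i F => .allI i (F.star p)
  | .exI i F => .exI i (F.star p)

open Classical in
/-- Replacing the members of the list `h` of predicate symbols by the corresponding predicate
variables `H`. -/
noncomputable def hide (h : List (PredSym Sym)) : Formula Sym Var → Formula Sym Var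
  | .bot => .bot
  | .pred q t => if q ∈ h then .pvar (.big q) t else .pred q t
  | .pvar x t => .pvar x t
  | .eq t₁ t₂ => .eq t₁ t₂
  | .ineq c t₁ t₂ => .ineq c t₁ t₂
  | .and F G => .and (F.hide h) (G.hide h)
  | .or F G => .or (F.hide h) (G.hide h)
  | .imp F G => .imp (F.hide h) (G.hide h)
  | .allG x F => .allG x (F.hide h)
  | .exG x F => .exG x (F.hide h)
  | .allI i F => .allI i (F.hide h)
  | .exI i F => .exI i (F.hide h)

end Formula

namespace SOFormula

def exPs (l : List (PredVar Sym)) (F : SOFormula Sym Var) : SOFormula Sym Var := l.foldr .exP F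

noncomputable def hide (h : List (PredSym Sym)) : SOFormula Sym Var → SOFormula Sym Var
  | .fo F => .fo (F.hide h)
  | .neg F => .neg (F.hide h)
  | .and F G => .and (F.hide h) (G.hide h)
  | .exP x F => .exP x (F.hide h)

end SOFormula

/-- `SM_p[F]`, that is, `F ∧ ¬ ∃ u ((u < p) ∧ F*(u))`. -/
noncomputable def SM (p : List (PredSym Sym)) (F : Formula Sym Var) : SOFormula Sym Var :=
  .and (.fo F) (.neg (.exPs (p.map .small) (.fo (.and (.smallLt p) (F.star p)))))

/-- `M` is a `p`-stable model with private symbols `h` of the finite list `Γ` of sentences: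
a model of `∃ H (SM_p[F])`, with `h` replaced by `H`, where `F` is the conjunction of `Γ`. -/
def IsStableModelWithPrivate {D N : Type*} (p h : List (PredSym Sym))
    (Γ : List (Formula Sym Var)) (M : Interp Sym D N) : Prop :=
  (SOFormula.exPs (h.map .big) ((SM p (.conj Γ)).hide h)).IsModel M

end SM

/-! ### The translation `τ*` -/

section TauStar

variable {Sym Var : Type*}

/-- The formula `val_t(Z)`. The number `n` is such that the integer variables with indices at
least `n` do not occur in `Z`; they serve as fresh variables. -/
def val : Term Sym Var → GTerm Sym Var → ℕ → Formula Sym Var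
  | .inf, Z, _ => .eq Z .inf
  | .num m, Z, _ => .eq Z (.int (.num m))
  | .sym c, Z, _ => .eq Z (.sym c)
  | .sup, Z, _ => .eq Z .sup
  | .var x, Z, _ => .eq Z (.var (.prog x))
  | .op .add t₁ t₂, Z, n => .exIs [n, n + 1] (.conj
      [.eq Z (.int (.add (.var n) (.var (n + 1)))),
       val t₁ (.int (.var n)) (n + 2), val t₂ (.int (.var (n + 1))) (n + 2)])
  | .op .sub t₁ t₂, Z, n => .exIs [n, n + 1] (.conj
      [.eq Z (.int (.sub (.var n) (.var (n + 1)))),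
       val t₁ (.int (.var n)) (n + 2), val t₂ (.int (.var (n + 1))) (n + 2)])
  | .op .mul t₁ t₂, Z, n => .exIs [n, n + 1] (.conj
      [.eq Z (.int (.mul (.var n) (.var (n + 1)))),
       val t₁ (.int (.var n)) (n + 2), val t₂ (.int (.var (n + 1))) (n + 2)])
  | .op .div t₁ t₂, Z, n => .exIs [n, n + 1, n + 2, n + 3] (.conj
      [.eq (.int (.var n)) (.int (.add (.mul (.var (n + 1)) (.var (n + 2))) (.var (n + 3)))),
       val t₁ (.int (.var n)) (n + 4), val t₂ (.int (.var (n + 1))) (n + 4),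
       .ineq .ne (.int (.var (n + 1))) (.int (.num 0)),
       remainderCond (n + 3) (n + 1),
       .eq Z (.int (.var (n + 2)))])
  | .op .mod t₁ t₂, Z, n => .exIs [n, n + 1, n + 2, n + 3] (.conj
      [.eq (.int (.var n)) (.int (.add (.mul (.var (n + 1)) (.var (n + 2))) (.var (n + 3)))),
       val t₁ (.int (.var n)) (n + 4), val t₂ (.int (.var (n + 1))) (n + 4),
       .ineq .ne (.int (.var (n + 1))) (.int (.num 0)),
       remainderCond (n + 3) (n + 1),
       .eq Z (.int (.var (n + 3)))])
  | .op .interval t₁ t₂, Z, n => .exIs [n, n + 1, n + 2] (.conj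
      [val t₁ (.int (.var n)) (n + 3), val t₂ (.int (.var (n + 1))) (n + 3),
       .ineq .le (.int (.var n)) (.int (.var (n + 2))),
       .ineq .le (.int (.var (n + 2))) (.int (.var (n + 1))),
       .eq Z (.int (.var (n + 2)))])
where
  /-- `R` is a remainder for the divisor `J` (with quotients rounded down):
  `(0 ≤ R ∧ R < J) ∨ (J < R ∧ R ≤ 0)`. -/
  remainderCond (R J : ℕ) : Formula Sym Var :=
    .or (.and (.ineq .le (.int (.num 0)) (.int (.var R))) (.ineq .lt (.int (.var R)) (.int (.var J))))
      (.and (.ineq .lt (.int (.var J)) (.int (.var R))) (.ineq .le (.int (.var R)) (.int (.num 0))))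

/-- `val_{t₁}(Z₁) ∧ ⋯ ∧ val_{tₖ}(Zₖ)` for the arguments of an atom. -/
def valArgs (a : Atom Sym Var) : Formula Sym Var :=
  .conj ((List.finRange a.pred.arity).map fun i => val (a.args i) (.var (.fresh i.val)) 0)

/-- `p(Z₁, …, Zₖ)` for the predicate symbol of an atom. -/
def freshAtom (a : Atom Sym Var) : Formula Sym Var :=
  .pred a.pred fun i => .var (.fresh i.val)

def tauB : BodyElt Sym Var → Formula Sym Var
  | .pos a => .exGs (Formula.freshVars a.pred.arity) (.and (valArgs a) (freshAtom a))
  | .neg a => .exGs (Formula.freshVars a.pred.arity) (.and (valArgs a) (.neg (freshAtom a)))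
  | .negneg a =>
      .exGs (Formula.freshVars a.pred.arity) (.and (valArgs a) (.neg (.neg (freshAtom a))))
  | .comp c t₁ t₂ =>
      .exGs (Formula.freshVars 2) (.conj
        [val t₁ (.var (.fresh 0)) 0, val t₂ (.var (.fresh 1)) 0,
         match c with
         | .eq => .eq (.var (.fresh 0)) (.var (.fresh 1))
         | .ineq c => .ineq c (.var (.fresh 0)) (.var (.fresh 1))])

def tauStarHead : Head Sym Var → Formula Sym Var
  | .basic a => .allGs (Formula.freshVars a.pred.arity) (.imp (valArgs a) (freshAtom a))
  | .choice a => .allGs (Formula.freshVars a.pred.arity)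
      (.imp (valArgs a) (.or (freshAtom a) (.neg (freshAtom a))))
  | .empty => .bot

/-- `τ*R`. -/
def tauStarRule (R : Rule Sym Var) : Formula Sym Var :=
  .allGs (R.vars.map .prog) (.imp (.conj (R.body.map tauB)) (tauStarHead R.head))

/-- `τ*Π` for a program `Π`. -/
noncomputable def tauStar (P : Finset (Rule Sym Var)) : List (Formula Sym Var) :=
  P.toList.map tauStarRule

end TauStar

/-! ### Programs with input and output -/

structure IOProgram (Sym Var : Type*) where
  rules : Finset (Rule Sym Var)
  placeholders : Finset Sym
  input : Finset (PredSym Sym)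
  output : Finset (PredSym Sym)
  input_not_in_heads : ∀ R ∈ rules, ∀ q ∈ input, q ∉ R.head.preds
  disjoint_input_output : Disjoint input output

namespace IOProgram

variable {Sym Var : Type*} (Ω : IOProgram Sym Var)

open Classical in
/-- The predicate symbols that occur in the rules. -/
noncomputable def occurring : Finset (PredSym Sym) := Ω.rules.biUnion fun R => R.preds.toFinset

open Classical in
/-- Public symbols. -/
noncomputable def publicSyms : Finset (PredSym Sym) := Ω.input ∪ Ω.output

open Classical in
/-- The list `h` of private symbols. -/
noncomputable def privateSyms : List (PredSym Sym) := (Ω.occurring \ Ω.publicSyms).toList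

open Classical in
/-- The list `p` of the predicate symbols occurring in the rules other than input symbols. -/
noncomputable def intensionalSyms : List (PredSym Sym) := (Ω.occurring \ Ω.input).toList

/-- Valuations: precomputed terms different from placeholders are assigned to placeholders. -/
structure Valuation where
  toFun : {c // c ∈ Ω.placeholders} → PTerm Sym
  ne_placeholder : ∀ c, ∀ d ∈ Ω.placeholders, toFun c ≠ .sym d

/-- The second component of an input: a set of precomputed atoms that do not contain
placeholders and whose predicate symbols are input symbols. -/
def IsInputSet (i : Set (PAtom Sym)) : Prop :=
  ∀ a ∈ i, a.1 ∈ Ω.input ∧ ∀ j, ∀ c ∈ Ω.placeholders, a.2 j ≠ .sym c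

variable {Ω}

open Classical in
/-- The precomputed term that corresponds to a symbolic constant under a valuation: `v(c)` if `c`
is a placeholder, and `c` otherwise. -/
noncomputable def Valuation.apply (v : Ω.Valuation) (c : Sym) : PTerm Sym :=
  if h : c ∈ Ω.placeholders then v.toFun ⟨c, h⟩ else .sym c

/-- A precomputed atom as a fact. -/
def fact (a : PAtom Sym) : Rule Sym Var :=
  ⟨.basic ⟨a.1, fun j => (a.2 j).toTerm⟩, []⟩

variable (Ω)

/-- The program `Ω(v, i)` (an infinite set of rules if `i` is infinite). -/
def instantiate (v : Ω.Valuation) (i : Set (PAtom Sym)) : Set (Rule Sym Var) :=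
  (fun R : Rule Sym Var => R.replace (fun c => (v.apply c).toTerm) .var) '' (Ω.rules : Set _) ∪
    fact '' i

/-- `I` is an io-model of `Ω` for the input `(v, i)`. -/
def IsIOModel [PrecomputedOrder Sym] (v : Ω.Valuation) (i I : Set (PAtom Sym)) : Prop :=
  ∃ J : Set (PAtom Sym), IsStableModelOf (Ω.instantiate v i) J ∧ I = {a ∈ J | a.1 ∈ Ω.publicSyms}

/-- The set of atoms in `I` that begin with an input symbol. -/
def inputPart (I : Set (PAtom Sym)) : Set (PAtom Sym) := {a ∈ I | a.1 ∈ Ω.input}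

variable {Ω}

/-- The interpretation `I^v`. -/
noncomputable def interp [PrecomputedOrder Sym] (v : Ω.Valuation) (I : Set (PAtom Sym)) :
    Interp Sym (PTerm Sym) ℤ where
  incl := .num
  incl_injective := fun _ _ h => PTerm.num.inj h
  inf := .inf
  num := id
  sym := v.apply
  sup := .sup
  add := (· + ·)
  sub := (· - ·)
  mul := (· * ·)
  ineq := Ineq.Holds
  pred := fun p t => (⟨p, t⟩ : PAtom Sym) ∈ I

end IOProgram

end AspIO

/-! Both sides are brought to the logic of here-and-there, where a formula is evaluated at a pair `Y
⊆ X` of sets of atoms. For such a pair, `Y` satisfies the reduct of `F` relative to `X` exactly when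
the pair satisfies `F` (`PForm.reduct_sat_iff`). So `X` is stable iff `(X, X)` is a model and `(Y,
X)` is not a model for any `Y ⊂ X`.

On the first-order side, let `Y` be `J` with the extents of `p` replaced by the values of the
predicate variables `u`. When `Y ⊆ J`, the formula `F*(u)` obtained from a rule of `τ*Π` holds iff
all ground instances of the rule hold at `(Y, J)` (`sat_star_tauStarRule`). This rests on
`sat_star_val`: `val_t(Z)` says that `Z` is among the values of the ground term obtained from `t`.
The second-order quantifier over private symbols turns into a choice of a set `J` agreeing with `I`
outside `h` (`isStableModelWithPrivate_iff`).

Both conditions then say that `J` satisfies the ground rules and no competitor `Y ⊂ J` does so at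
`(Y, J)`; only the class of competitors differs. A stable model of `Ω(v, i)` competes with all `Y`
containing `i`, an `SM` model with all `Y` that agree with `J` on symbols outside `p`. The classes
coincide because `J` has no atoms outside `p` other than those in `i`. If `J` is a stable model,
this follows from supportedness (`mem_or_mem_head_preds`), as input symbols are not in heads. In the
other direction it follows from `I^in = i` and the assumption that output symbols used in `I` occur
in the rules. -/

namespace AspIO

/-! ### Here-and-there satisfaction and reducts. -/

namespace PForm

variable {A : Type*}

/-- Satisfaction in the logic of here-and-there: `Y` is the world "here", `X` the world
"there". -/
def HSat (Y X : Set A) : PForm A → Prop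
  | .bot => False
  | .atom a => a ∈ Y
  | .and F G => F.HSat Y X ∧ G.HSat Y X
  | .or F G => F.HSat Y X ∨ G.HSat Y X
  | .imp F G => (F.HSat Y X → G.HSat Y X) ∧ (F.Sat X → G.Sat X)

/-- Persistence: truth "here" is preserved "there". The implication case holds because `HSat`
includes the classical implication as a conjunct. -/
theorem HSat.sat {Y X : Set A} (h : Y ⊆ X) : ∀ {F : PForm A}, F.HSat Y X → F.Sat X
  | .bot, H => H
  | .atom _, H => h H
  | .and _ _, H => ⟨HSat.sat h H.1, HSat.sat h H.2⟩
  | .or _ _, H => H.imp (HSat.sat h) (HSat.sat h)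
  | .imp _ _, H => H.2

theorem hSat_self (X : Set A) : ∀ F : PForm A, F.HSat X X ↔ F.Sat X
  | .bot => Iff.rfl
  | .atom _ => Iff.rfl
  | .and F G => and_congr (hSat_self X F) (hSat_self X G)
  | .or F G => or_congr (hSat_self X F) (hSat_self X G)
  | .imp F G => by simp [HSat, Sat, hSat_self X F, hSat_self X G]

/-- Where `X` satisfies a subformula, the reduct keeps its main connective and induction applies.
Where it does not, the reduct is `⊥`, and by persistence the here-and-there value is false too. -/
theorem reduct_sat_iff {Y X : Set A} (h : Y ⊆ X) :
    ∀ F : PForm A, (F.reduct X).Sat Y ↔ F.HSat Y X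
  | .bot => Iff.rfl
  | .atom a => by
      by_cases ha : a ∈ X
      · simp [reduct, ha, Sat, HSat]
      · simpa [reduct, ha, Sat, HSat] using fun hY => ha (h hY)
  | .and F G => by
      have hF := reduct_sat_iff h F
      have hG := reduct_sat_iff h G
      by_cases hs : (PForm.and F G).Sat X
      · rw [reduct, if_pos hs]
        exact and_congr hF hG
      · rw [reduct, if_neg hs]
        exact iff_of_false id fun H => hs (HSat.sat h H)
  | .or F G => by
      have hF := reduct_sat_iff h F
      have hG := reduct_sat_iff h G
      by_cases hs : (PForm.or F G).Sat X
      · rw [reduct, if_pos hs]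
        exact or_congr hF hG
      · rw [reduct, if_neg hs]
        exact iff_of_false id fun H => hs (HSat.sat h H)
  | .imp F G => by
      have hF := reduct_sat_iff h F
      have hG := reduct_sat_iff h G
      by_cases hs : (PForm.imp F G).Sat X
      · rw [reduct, if_pos hs]
        exact (imp_congr hF hG).trans (and_iff_left hs).symm
      · rw [reduct, if_neg hs]
        exact iff_of_false id fun H => hs (HSat.sat h H)

theorem hSat_conj {Y X : Set A} : ∀ {l : List (PForm A)},
    (conj l).HSat Y X ↔ ∀ F ∈ l, F.HSat Y X
  | [] => by simp [conj, top, HSat]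
  | F :: l => by simp [conj, HSat, hSat_conj (l := l)]

theorem hSat_disj {Y X : Set A} : ∀ {l : List (PForm A)},
    (disj l).HSat Y X ↔ ∃ F ∈ l, F.HSat Y X
  | [] => by simp [disj, HSat]
  | F :: l => by simp [disj, HSat, hSat_disj (l := l)]

theorem isStableModel_iff {Γ : Set (PForm A)} {X : Set A} :
    IsStableModel Γ X ↔
      (∀ F ∈ Γ, F.HSat X X) ∧ ∀ Y ⊆ X, (∀ F ∈ Γ, F.HSat Y X) → Y = X := by
  constructor
  · intro H
    refine ⟨fun F hF => (reduct_sat_iff subset_rfl F).1 (H.1 F hF), fun Y hY hs => ?_⟩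
    exact hY.antisymm (H.2 (fun F hF => (reduct_sat_iff hY F).2 (hs F hF)) hY)
  · rintro ⟨H₁, H₂⟩
    refine ⟨fun F hF => (reduct_sat_iff subset_rfl F).2 (H₁ F hF), fun Y hY hle => ?_⟩
    exact (H₂ Y hle fun F hF => (reduct_sat_iff hle F).1 (hY F hF)).ge

end PForm

/-! ### Composition of substitutions, and dependence on occurring variables only. -/

section Grounding

variable {Sym Var Var' Var'' : Type*}

theorem PTerm.replace_toTerm_sym (s : Var → Term Sym Var') (r : PTerm Sym) :
    (r.toTerm : Term Sym Var).replace .sym s = r.toTerm := by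
  cases r <;> rfl

theorem PTerm.values_toTerm (r : PTerm Sym) : (r.toTerm : Term Sym Empty).values = {r} := by
  cases r <;> rfl

/-- Values of placeholders are precomputed, hence contain no variables, so replacing placeholders
and then variables can be done in one simultaneous replacement. -/
theorem Term.replace_replace (f : Sym → PTerm Sym) (s : Var → Term Sym Var') (t : Term Sym Var) :
    (t.replace (fun c => (f c).toTerm) .var).replace .sym s =
      t.replace (fun c => (f c).toTerm) s := by
  induction t with
  | sym c => exact PTerm.replace_toTerm_sym s (f c)
  | op o t₁ t₂ h₁ h₂ => simp only [replace, h₁, h₂]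
  | _ => rfl

theorem Atom.replace_replace (f : Sym → PTerm Sym) (s : Var → Term Sym Var') (a : Atom Sym Var) :
    (a.replace (fun c => (f c).toTerm) .var).replace .sym s =
      a.replace (fun c => (f c).toTerm) s := by
  simp only [replace, Term.replace_replace]

theorem Rule.replace_replace (f : Sym → PTerm Sym) (s : Var → Term Sym Var') (R : Rule Sym Var) :
    (R.replace (fun c => (f c).toTerm) .var).replace .sym s =
      R.replace (fun c => (f c).toTerm) s := by
  rcases R with ⟨H, B⟩
  simp only [replace, List.map_map, Rule.mk.injEq]
  refine ⟨?_, List.map_congr_left fun b _ => ?_⟩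
  · cases H <;> simp [Head.replace, Atom.replace_replace]
  · cases b <;> simp [BodyElt.replace, Atom.replace_replace, Term.replace_replace]

theorem Term.replace_congr {f : Sym → Term Sym Var'} {s s' : Var → Term Sym Var'}
    {t : Term Sym Var} (h : ∀ x ∈ t.vars, s x = s' x) : t.replace f s = t.replace f s' := by
  induction t with
  | var x => exact h x (by simp [vars])
  | op o t₁ t₂ h₁ h₂ =>
    simp only [vars, List.mem_append] at h
    simp only [replace, h₁ fun x hx => h x (.inl hx), h₂ fun x hx => h x (.inr hx)]
  | _ => rfl

theorem Atom.replace_congr {f : Sym → Term Sym Var'} {s s' : Var → Term Sym Var'}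
    {a : Atom Sym Var} (h : ∀ x ∈ a.vars, s x = s' x) : a.replace f s = a.replace f s' := by
  simp only [replace, Atom.mk.injEq, heq_eq_eq, true_and]
  funext i
  exact Term.replace_congr fun x hx => h x (by
    simp only [vars, List.mem_flatMap, List.mem_finRange, true_and]; exact ⟨i, hx⟩)

theorem BodyElt.replace_congr {f : Sym → Term Sym Var'} {s s' : Var → Term Sym Var'}
    {b : BodyElt Sym Var} (h : ∀ x ∈ b.vars, s x = s' x) : b.replace f s = b.replace f s' := by
  cases b with
  | comp c t₁ t₂ =>
    simp only [vars, List.mem_append] at h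
    simp only [replace, Term.replace_congr fun x hx => h x (.inl hx),
      Term.replace_congr fun x hx => h x (.inr hx)]
  | _ a => exact congrArg _ (Atom.replace_congr h)

theorem Head.replace_congr {f : Sym → Term Sym Var'} {s s' : Var → Term Sym Var'}
    {H : Head Sym Var} (h : ∀ x ∈ H.vars, s x = s' x) : H.replace f s = H.replace f s' := by
  cases H with
  | empty => rfl
  | _ a => exact congrArg _ (Atom.replace_congr h)

theorem Rule.replace_congr {f : Sym → Term Sym Var'} {s s' : Var → Term Sym Var'}
    {R : Rule Sym Var} (h : ∀ x ∈ R.vars, s x = s' x) : R.replace f s = R.replace f s' := by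
  simp only [vars, List.mem_append, List.mem_flatMap] at h
  simp only [replace, Rule.mk.injEq]
  exact ⟨Head.replace_congr fun x hx => h x (.inl hx), List.map_congr_left fun b hb =>
    BodyElt.replace_congr fun x hx => h x (.inr ⟨b, hb, hx⟩)⟩

end Grounding

/-! ### Here-and-there meaning of `τ` for ground rules. -/

section PropositionalTranslation

variable {Sym : Type*}

/-- `opValues` is empty unless both arguments are numerals. This is why the variables `I`, `J` in
`val_t` may be of sort integer. -/
theorem mem_values_op {o : OpName} {t₁ t₂ : Term Sym Empty} {r : PTerm Sym} :
    r ∈ (Term.op o t₁ t₂).values ↔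
      ∃ m n : ℤ, .num m ∈ t₁.values ∧ .num n ∈ t₂.values ∧ r ∈ opValues o (.num m) (.num n) := by
  simp only [Term.values, Finset.mem_biUnion]
  constructor
  · rintro ⟨r₁, h₁, r₂, h₂, h⟩
    cases r₁ <;> cases r₂ <;> cases o <;>
      first
        | exact ⟨_, _, h₁, h₂, h⟩
        | exact absurd h (Finset.notMem_empty _)
  · rintro ⟨m, n, h₁, h₂, h⟩
    exact ⟨_, h₁, _, h₂, h⟩

theorem Atom.mem_values {a : Atom Sym Empty} {r : Fin a.pred.arity → PTerm Sym} :
    r ∈ a.values ↔ ∀ j, r j ∈ (a.args j).values := by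
  simp [Atom.values]

variable {Y X : Set (PAtom Sym)}

theorem hSat_tauHead_basic {a : Atom Sym Empty} :
    (tauHead (.basic a)).HSat Y X ↔ ∀ r ∈ a.values, (⟨a.pred, r⟩ : PAtom Sym) ∈ Y := by
  simp [tauHead, PForm.hSat_conj, PForm.HSat]

theorem hSat_tauHead_choice {a : Atom Sym Empty} :
    (tauHead (.choice a)).HSat Y X ↔ ∀ r ∈ a.values,
      (⟨a.pred, r⟩ : PAtom Sym) ∈ Y ∨
        ((⟨a.pred, r⟩ : PAtom Sym) ∉ Y ∧ (⟨a.pred, r⟩ : PAtom Sym) ∉ X) := by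
  simp [tauHead, PForm.hSat_conj, PForm.HSat, PForm.neg, PForm.Sat]

theorem hSat_tauHead_congr {H : Head Sym Empty}
    (h : ∀ q ∈ H.preds, ∀ r, (⟨q, r⟩ : PAtom Sym) ∈ Y ↔ (⟨q, r⟩ : PAtom Sym) ∈ X) :
    (tauHead H).HSat Y X ↔ (tauHead H).HSat X X := by
  cases H with
  | basic a =>
    simp only [hSat_tauHead_basic, h a.pred (by simp [Head.preds])]
  | choice a =>
    simp only [hSat_tauHead_choice, h a.pred (by simp [Head.preds])]
  | empty => rfl

variable [PrecomputedOrder Sym]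

theorem hSat_tauBody_pos {a : Atom Sym Empty} :
    (tauBody (.pos a)).HSat Y X ↔ ∃ r ∈ a.values, (⟨a.pred, r⟩ : PAtom Sym) ∈ Y := by
  simp [tauBody, PForm.hSat_disj, PForm.HSat]

theorem hSat_tauBody_neg {a : Atom Sym Empty} :
    (tauBody (.neg a)).HSat Y X ↔ ∃ r ∈ a.values,
      (⟨a.pred, r⟩ : PAtom Sym) ∉ Y ∧ (⟨a.pred, r⟩ : PAtom Sym) ∉ X := by
  simp [tauBody, PForm.hSat_disj, PForm.HSat, PForm.neg, PForm.Sat]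

theorem hSat_tauBody_negneg {a : Atom Sym Empty} :
    (tauBody (.negneg a)).HSat Y X ↔ ∃ r ∈ a.values,
      ¬ ((⟨a.pred, r⟩ : PAtom Sym) ∉ Y ∧ (⟨a.pred, r⟩ : PAtom Sym) ∉ X) ∧
        (⟨a.pred, r⟩ : PAtom Sym) ∈ X := by
  simp [tauBody, PForm.hSat_disj, PForm.HSat, PForm.neg, PForm.Sat]

theorem hSat_tauBody_comp {c : CompSym} {t₁ t₂ : Term Sym Empty} :
    (tauBody (.comp c t₁ t₂)).HSat Y X ↔
      ∃ r₁ ∈ t₁.values, ∃ r₂ ∈ t₂.values, c.Holds r₁ r₂ := by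
  by_cases h : ∃ r₁ ∈ t₁.values, ∃ r₂ ∈ t₂.values, c.Holds r₁ r₂
  · simp only [tauBody, h, if_true, PForm.top, PForm.HSat, imp_self, and_self]
  · simp only [tauBody, h, if_false, PForm.HSat]

/-- If the body holds at `(Y, X)`, it holds in `X` by persistence, and so does the head. The head is
then true at `(Y, X)` as well, since `Y` and `X` have the same atoms with its predicate symbol. -/
theorem hSat_tauRule_of_head_congr {R : Rule Sym Empty} (hYX : Y ⊆ X)
    (h : ∀ q ∈ R.head.preds, ∀ r, (⟨q, r⟩ : PAtom Sym) ∈ Y ↔ (⟨q, r⟩ : PAtom Sym) ∈ X)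
    (hR : (tauRule R).HSat X X) : (tauRule R).HSat Y X :=
  ⟨fun hB => (hSat_tauHead_congr h).2 ((PForm.hSat_self X _).2 (hR.2 (hB.sat hYX))), hR.2⟩

end PropositionalTranslation

/-! ### Blocks of quantifiers. -/

section Quantifiers

variable {Sym Var D N : Type*} {M : Interp Sym D N}
  {ρ : (x : PredVar Sym) → (Fin x.arity → D) → Prop} {g : GVar Var → D} {k : ℕ → N}

open Classical in
-- The induction step for quantifier blocks. Assignments are dependent functions so that the lemma
-- covers both object variables and predicate variables of varying arities; repetitions in the list
-- are harmless.
theorem exists_update_iff {α : Type*} {β : α → Type*} {l : List α} {x : α} {g : (a : α) → β a}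
    {P : ((a : α) → β a) → Prop} :
    (∃ d, ∃ g' : (a : α) → β a, (∀ y ∉ l, g' y = Function.update g x d y) ∧ P g') ↔
      ∃ g' : (a : α) → β a, (∀ y ∉ x :: l, g' y = g y) ∧ P g' := by
  constructor
  · rintro ⟨d, g', h, H⟩
    refine ⟨g', fun y hy => ?_, H⟩
    rw [List.mem_cons, not_or] at hy
    rw [h y hy.2, Function.update_of_ne hy.1]
  · rintro ⟨g', h, H⟩
    refine ⟨g' x, g', fun y hy => ?_, H⟩
    by_cases hyx : y = x
    · subst hyx; simp
    · rw [Function.update_of_ne hyx]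
      exact h y (by simp [hyx, hy])

theorem Formula.sat_exGs {l : List (GVar Var)} {F : Formula Sym Var} :
    (Formula.exGs l F).Sat M ρ g k ↔
      ∃ g' : GVar Var → D, (∀ x ∉ l, g' x = g x) ∧ F.Sat M ρ g' k := by
  induction l generalizing g with
  | nil =>
    simp only [exGs, List.foldr_nil, List.not_mem_nil, not_false_eq_true, forall_const]
    exact ⟨fun h => ⟨g, fun _ => rfl, h⟩, fun ⟨g', h, H⟩ => funext h ▸ H⟩
  | cons x l ih =>
    rw [← exists_update_iff]
    exact exists_congr fun d => ih

theorem Formula.sat_allGs {l : List (GVar Var)} {F : Formula Sym Var} :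
    (Formula.allGs l F).Sat M ρ g k ↔
      ∀ g' : GVar Var → D, (∀ x ∉ l, g' x = g x) → F.Sat M ρ g' k := by
  induction l generalizing g with
  | nil =>
    simp only [allGs, List.foldr_nil, List.not_mem_nil, not_false_eq_true, forall_const]
    exact ⟨fun h g' hg => (funext hg : g' = g) ▸ h, fun h => h g fun _ => rfl⟩
  | cons x l ih =>
    -- The universal block is treated as the negation of an existential one.
    have key := exists_update_iff (l := l) (x := x) (g := g) (P := fun g' => ¬ F.Sat M ρ g' k)
    have := not_congr key
    push Not at this
    rw [← this]
    exact forall_congr' fun d => ih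

theorem SOFormula.sat_exPs {l : List (PredVar Sym)} {F : SOFormula Sym Var} :
    (SOFormula.exPs l F).Sat M g k ρ ↔
      ∃ ρ' : (x : PredVar Sym) → (Fin x.arity → D) → Prop,
        (∀ x ∉ l, ρ' x = ρ x) ∧ F.Sat M g k ρ' := by
  induction l generalizing ρ with
  | nil =>
    simp only [exPs, List.foldr_nil, List.not_mem_nil, not_false_eq_true, forall_const]
    exact ⟨fun h => ⟨ρ, fun _ => rfl, h⟩, fun ⟨ρ', h, H⟩ => funext h ▸ H⟩
  | cons x l ih =>
    rw [← exists_update_iff]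
    exact exists_congr fun d => ih

theorem mem_freshVars {n : ℕ} {x : GVar Var} :
    x ∈ Formula.freshVars n ↔ ∃ j : Fin n, x = .fresh j := by
  simp only [Formula.freshVars, List.mem_map, List.mem_range]
  exact ⟨fun ⟨j, h, e⟩ => ⟨⟨j, h⟩, e.symm⟩, fun ⟨j, e⟩ => ⟨j, j.2, e.symm⟩⟩

/-- The assignment obtained from `g` by giving the values `r` to the first `n` fresh variables. -/
def assignFresh {n : ℕ} (g : GVar Var → D) (r : Fin n → D) : GVar Var → D
  | .prog x => g (.prog x)
  | .fresh j => if h : j < n then r ⟨j, h⟩ else g (.fresh j)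

@[simp] theorem assignFresh_prog {n : ℕ} (r : Fin n → D) (x : Var) :
    assignFresh g r (.prog x) = g (.prog x) := rfl

@[simp] theorem assignFresh_fresh {n : ℕ} (r : Fin n → D) (j : Fin n) :
    assignFresh g r (.fresh j) = r j := by
  simp [assignFresh]

theorem exists_assignFresh {n : ℕ} {g' : GVar Var → D}
    (h : ∀ x ∉ Formula.freshVars n, g' x = g x) : ∃ r : Fin n → D, g' = assignFresh g r := by
  refine ⟨fun j => g' (.fresh j), funext fun x => ?_⟩
  rcases x with x | j
  · exact h _ (by simp [mem_freshVars])
  · by_cases hj : j < n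
    · simp [assignFresh, hj]
    · simp only [assignFresh, hj, dite_false]
      refine h _ fun hx => ?_
      obtain ⟨i, hi⟩ := mem_freshVars.1 hx
      cases hi
      exact hj i.2

theorem assignFresh_eq {n : ℕ} (r : Fin n → D) (x : GVar Var) (h : x ∉ Formula.freshVars n) :
    assignFresh g r x = g x := by
  rcases x with x | j
  · rfl
  · have : ¬ j < n := fun hj => h (mem_freshVars.2 ⟨⟨j, hj⟩, rfl⟩)
    simp [assignFresh, this]

theorem Formula.sat_exGs_freshVars {n : ℕ} {F : Formula Sym Var} :
    (Formula.exGs (Formula.freshVars n) F).Sat M ρ g k ↔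
      ∃ r : Fin n → D, F.Sat M ρ (assignFresh g r) k := by
  rw [sat_exGs]
  constructor
  · rintro ⟨g', h, H⟩
    obtain ⟨r, rfl⟩ := exists_assignFresh h
    exact ⟨r, H⟩
  · rintro ⟨r, H⟩
    exact ⟨_, assignFresh_eq r, H⟩

theorem Formula.sat_allGs_freshVars {n : ℕ} {F : Formula Sym Var} :
    (Formula.allGs (Formula.freshVars n) F).Sat M ρ g k ↔
      ∀ r : Fin n → D, F.Sat M ρ (assignFresh g r) k := by
  rw [sat_allGs]
  constructor
  · exact fun H r => H _ (assignFresh_eq r)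
  · intro H g' h
    obtain ⟨r, rfl⟩ := exists_assignFresh h
    exact H r

theorem Formula.sat_conj {l : List (Formula Sym Var)} :
    (Formula.conj l).Sat M ρ g k ↔ ∀ F ∈ l, F.Sat M ρ g k := by
  induction l with
  | nil => simp [conj, top, Sat]
  | cons F l ih => simp [conj, Sat, ih]

end Quantifiers

/-! ### Behaviour of the operator `*`. -/

namespace Formula

variable {Sym Var D N : Type*} {p : List (PredSym Sym)}

theorem star_exGs (l : List (GVar Var)) (F : Formula Sym Var) :
    (exGs l F).star p = exGs l (F.star p) := by
  induction l with
  | nil => rfl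
  | cons x l ih => exact congrArg (Formula.exG x) ih

theorem star_allGs (l : List (GVar Var)) (F : Formula Sym Var) :
    (allGs l F).star p = allGs l (F.star p) := by
  induction l with
  | nil => rfl
  | cons x l ih => exact congrArg (Formula.allG x) ih

theorem sat_star_conj {M : Interp Sym D N} {ρ : (x : PredVar Sym) → (Fin x.arity → D) → Prop}
    {g : GVar Var → D} {k : ℕ → N} {l : List (Formula Sym Var)} :
    ((conj l).star p).Sat M ρ g k ↔ ∀ F ∈ l, (F.star p).Sat M ρ g k := by
  induction l with
  | nil => simp [conj, top, star, Sat]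
  | cons F l ih => simp [conj, star, Sat, ih]

/-- With no intensional symbols, `*` only duplicates implications. Facts about ordinary satisfaction
thus become the case `p = []` of facts about starred formulas. -/
theorem sat_star_nil {M : Interp Sym D N} {ρ : (x : PredVar Sym) → (Fin x.arity → D) → Prop}
    {g : GVar Var → D} {k : ℕ → N} {F : Formula Sym Var} :
    (F.star []).Sat M ρ g k ↔ F.Sat M ρ g k := by
  induction F generalizing g k <;> simp_all [star, Sat]

end Formula

/-! ### Correctness of `val_t(Z)`. -/

section ValSemantics

variable {Sym Var : Type*} [PrecomputedOrder Sym] {Ω : IOProgram Sym Var} {v : Ω.Valuation}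
  {J : Set (PAtom Sym)} {p : List (PredSym Sym)}
  {ρ : (x : PredVar Sym) → (Fin x.arity → PTerm Sym) → Prop}

open IOProgram

/-- The ground term obtained by applying a valuation to the symbolic constants and the
assignment `s` to the variables. -/
noncomputable def Term.ground (v : Ω.Valuation) (s : Var → PTerm Sym) (t : Term Sym Var) :
    Term Sym Empty :=
  t.replace (fun c => (v.apply c).toTerm) (fun x => (s x).toTerm)

theorem num_le_num {m n : ℤ} : (PTerm.num m : PTerm Sym) ≤ .num n ↔ m ≤ n := by
  rw [← not_lt, ← not_lt, PrecomputedOrder.num_lt_num]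

/-- Existence and uniqueness of floor division for a divisor of either sign: two admissible
remainders differ by less than `|n|`, while their difference is a multiple of `n`. -/
theorem fdiv_remainder_unique {m n q r : ℤ} (hn : n ≠ 0) :
    (m = n * q + r ∧ ((0 ≤ r ∧ r < n) ∨ (n < r ∧ r ≤ 0))) ↔
      q = Int.fdiv m n ∧ r = m - n * Int.fdiv m n := by
  have hmod : m - n * Int.fdiv m n = Int.fmod m n := by
    have := Int.mul_fdiv_add_fmod m n
    omega
  have hm := Int.mul_fdiv_add_fmod m n
  rw [hmod]
  have hrem : (0 ≤ Int.fmod m n ∧ Int.fmod m n < n) ∨ (n < Int.fmod m n ∧ Int.fmod m n ≤ 0) := by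
    rcases lt_or_gt_of_ne hn with h | h
    · right
      -- A negative divisor is reduced to a positive one: negating both arguments of `Int.fmod`
      -- negates the result.
      have h₁ := Int.fmod_nonneg_of_pos (-m) (b := -n) (by omega)
      have h₂ := Int.fmod_lt_of_pos (-m) (b := -n) (by omega)
      rw [Int.neg_fmod_neg] at h₁ h₂
      omega
    · exact .inl ⟨Int.fmod_nonneg_of_pos m h, Int.fmod_lt_of_pos m h⟩
  constructor
  · rintro ⟨h, hr⟩
    have e : n * (q - Int.fdiv m n) = Int.fmod m n - r := by linarith
    have hlt : |n * (q - Int.fdiv m n)| < |n| := by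
      rw [e, abs_lt]
      -- In the mixed cases the two sign conditions on `n` contradict each other.
      rcases hr with hr | hr <;> rcases hrem with hrem | hrem <;>
        first
          | (rw [abs_of_pos (by omega : 0 < n)]; omega)
          | (rw [abs_of_neg (by omega : n < 0)]; omega)
    have hq : q - Int.fdiv m n = 0 := by
      rw [abs_mul] at hlt
      have := (mul_lt_iff_lt_one_right (abs_pos.2 hn)).1 hlt
      exact Int.abs_lt_one_iff.1 this
    rw [hq] at e
    exact ⟨by omega, by omega⟩
  · rintro ⟨rfl, rfl⟩
    exact ⟨hm.symm, hrem⟩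

/-- The hypothesis `hZ` expresses freshness: the value of `Z` does not depend on integer variables
with index at least `n`, so the quantifiers of `val` cannot capture it. The operator `*` has no
effect on the meaning because `val` contains no predicate symbols. -/
theorem sat_star_val (t : Term Sym Var) {Z : GTerm Sym Var} {n : ℕ}
    {g : GVar Var → PTerm Sym} {k : ℕ → ℤ}
    (hZ : ∀ k' : ℕ → ℤ, (∀ j < n, k' j = k j) →
      Z.eval (interp v J) g k' = Z.eval (interp v J) g k) :
    ((val t Z n).star p).Sat (interp v J) ρ g k ↔
      Z.eval (interp v J) g k ∈ (t.ground v fun x => g (.prog x)).values := by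
  induction t generalizing Z n k with
  | inf =>
    simp [val, Formula.star, Formula.Sat, GTerm.eval,
      Term.ground, Term.replace, Term.values, interp]
  | num m =>
    simp [val, Formula.star, Formula.Sat, GTerm.eval,
      Term.ground, Term.replace, Term.values, interp, ITerm.eval]
  | sym c =>
    simp [val, Formula.star, Formula.Sat, GTerm.eval,
      Term.ground, Term.replace, PTerm.values_toTerm, interp]
  | sup =>
    simp [val, Formula.star, Formula.Sat, GTerm.eval,
      Term.ground, Term.replace, Term.values, interp]
  | var x =>
    simp [val, Formula.star, Formula.Sat, GTerm.eval,
      Term.ground, Term.replace, PTerm.values_toTerm]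
  | op o t₁ t₂ ih₁ ih₂ =>
    -- Freshness for the recursive calls, where `Z` is one of the newly bound integer variables and
    -- the fresh indices start above it.
    have hint : ∀ {i m : ℕ} {k' : ℕ → ℤ}, i < m → ∀ k'' : ℕ → ℤ, (∀ j < m, k'' j = k' j) →
        (GTerm.int (.var i) : GTerm Sym Var).eval (interp v J) g k'' =
          (GTerm.int (.var i) : GTerm Sym Var).eval (interp v J) g k' := by
      intro i m k' hi k'' h
      simp [GTerm.eval, ITerm.eval, h i hi]
    have hg : (Term.op o t₁ t₂).ground v (fun x => g (.prog x)) =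
        .op o (t₁.ground v fun x => g (.prog x)) (t₂.ground v fun x => g (.prog x)) := rfl
    -- The next three facts say that binding the new variables (two, three or four of them,
    -- depending on the operation) leaves the value of `Z` unchanged.
    have hup : ∀ {a b : ℤ}, Z.eval (interp v J) g
        (Function.update (Function.update k n a) (n + 1) b) = Z.eval (interp v J) g k :=
      hZ _ fun j hj => by
        rw [Function.update_of_ne (by omega), Function.update_of_ne (by omega)]
    have hup₃ : ∀ {a b c : ℤ}, Z.eval (interp v J) g (Function.update
        (Function.update (Function.update k n a) (n + 1) b) (n + 2) c) =
          Z.eval (interp v J) g k :=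
      hZ _ fun j hj => by
        rw [Function.update_of_ne (by omega), Function.update_of_ne (by omega),
          Function.update_of_ne (by omega)]
    have hup₄ : ∀ {a b c d : ℤ}, Z.eval (interp v J) g (Function.update (Function.update
        (Function.update (Function.update k n a) (n + 1) b) (n + 2) c) (n + 3) d) =
          Z.eval (interp v J) g k :=
      hZ _ fun j hj => by
        rw [Function.update_of_ne (by omega), Function.update_of_ne (by omega),
          Function.update_of_ne (by omega), Function.update_of_ne (by omega)]
    rw [hg, mem_values_op]
    have hi₁ := fun m (hm : n < m) (k' : ℕ → ℤ) => ih₁ (hint (k' := k') hm)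
    have hi₂ := fun m (hm : n + 1 < m) (k' : ℕ → ℤ) => ih₂ (hint (k' := k') hm)
    cases o with
    | add | sub | mul =>
      refine exists_congr fun a => exists_congr fun b => ?_
      simp only [List.foldr, Formula.sat_star_conj]
      simp only [List.forall_mem_cons, List.not_mem_nil, false_imp_iff,
        Formula.star, Formula.Sat, hi₁ _ (by omega : n < n + 2), hi₂ _ (by omega : n + 1 < n + 2),
        hup]
      generalize GTerm.eval (interp v J) g k Z = z
      simp [GTerm.eval, ITerm.eval, interp, opValues]
      tauto
    | div | mod =>
      refine exists_congr fun a => exists_congr fun b => ?_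
      simp only [List.foldr, Formula.star, Formula.Sat, Formula.sat_star_conj]
      simp only [List.forall_mem_cons, List.not_mem_nil, false_imp_iff,
        Formula.star, Formula.Sat, hi₁ _ (by omega : n < n + 4), hi₂ _ (by omega : n + 1 < n + 4),
        hup₄, val.remainderCond]
      generalize GTerm.eval (interp v J) g k Z = z
      simp [GTerm.eval, ITerm.eval, interp, opValues, Ineq.Holds]
      by_cases hb : b = 0
      · simp [hb]
      · simp only [num_le_num, PrecomputedOrder.num_lt_num, hb, not_false_eq_true, if_false,
          Finset.mem_singleton, true_and]
        constructor
        · rintro ⟨q, r, h, h₁, h₂, hr, rfl⟩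
          obtain ⟨rfl, rfl⟩ := (fdiv_remainder_unique hb).1 ⟨h, hr⟩
          exact ⟨h₁, h₂, rfl⟩
        · rintro ⟨h₁, h₂, rfl⟩
          obtain ⟨h, hr⟩ := (fdiv_remainder_unique (m := a) hb).2 ⟨rfl, rfl⟩
          exact ⟨_, _, h, h₁, h₂, hr, rfl⟩
    | interval =>
      refine exists_congr fun a => exists_congr fun b => ?_
      simp only [List.foldr, Formula.star, Formula.Sat, Formula.sat_star_conj]
      simp only [List.forall_mem_cons, List.not_mem_nil, false_imp_iff,
        Formula.star, Formula.Sat, hi₁ _ (by omega : n < n + 3), hi₂ _ (by omega : n + 1 < n + 3),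
        hup₃]
      generalize GTerm.eval (interp v J) g k Z = z
      simp [GTerm.eval, ITerm.eval, interp, opValues, Ineq.Holds]
      simp only [num_le_num, and_assoc, eq_comm, implies_true]

end ValSemantics

/-! ### From `SM` with private symbols to here-and-there models of ground rules. -/

section RuleSemantics

variable {Sym Var : Type*} {Ω : IOProgram Sym Var} {v : Ω.Valuation}
  {I J : Set (PAtom Sym)} {p h : List (PredSym Sym)}
  {ρ : (x : PredVar Sym) → (Fin x.arity → PTerm Sym) → Prop}
  {g : GVar Var → PTerm Sym} {k : ℕ → ℤ}

open IOProgram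

/-- The set obtained from `J` by changing the extents of the members of `l` to those given
by `u`. -/
def overlay (l : List (PredSym Sym)) (u : (q : PredSym Sym) → (Fin q.arity → PTerm Sym) → Prop)
    (J : Set (PAtom Sym)) : Set (PAtom Sym) :=
  {a | (a.1 ∈ l ∧ u a.1 a.2) ∨ (a.1 ∉ l ∧ a ∈ J)}

/-- The extents of the predicate variables that correspond to intensional symbols. -/
def smallExtent (ρ : (x : PredVar Sym) → (Fin x.arity → PTerm Sym) → Prop) (q : PredSym Sym) :
    (Fin q.arity → PTerm Sym) → Prop :=
  ρ (.small q)

/-- The extents of the predicate variables that correspond to private symbols. -/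
def bigExtent (ρ : (x : PredVar Sym) → (Fin x.arity → PTerm Sym) → Prop) (q : PredSym Sym) :
    (Fin q.arity → PTerm Sym) → Prop :=
  ρ (.big q)

theorem overlay_nil (u : (q : PredSym Sym) → (Fin q.arity → PTerm Sym) → Prop)
    (J : Set (PAtom Sym)) : overlay [] u J = J := by
  ext a; simp [overlay]

theorem mem_overlay_of_notMem {l : List (PredSym Sym)}
    {u : (q : PredSym Sym) → (Fin q.arity → PTerm Sym) → Prop} {a : PAtom Sym} (ha : a.1 ∉ l) :
    a ∈ overlay l u J ↔ a ∈ J := by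
  simp [overlay, ha]

theorem mem_overlay_of_mem {l : List (PredSym Sym)}
    {u : (q : PredSym Sym) → (Fin q.arity → PTerm Sym) → Prop} {q : PredSym Sym} (hq : q ∈ l)
    {r : Fin q.arity → PTerm Sym} : (⟨q, r⟩ : PAtom Sym) ∈ overlay l u J ↔ u q r := by
  simp [overlay, hq]

theorem SOFormula.hide_exPs (l : List (PredVar Sym)) (F : SOFormula Sym Var) :
    (exPs l F).hide h = exPs l (F.hide h) := by
  induction l with
  | nil => rfl
  | cons x l ih => exact congrArg (SOFormula.exP x) ih

theorem smallExtent_assignFresh {q : PredSym Sym} {r : Fin q.arity → PTerm Sym} :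
    ρ (.small q) (fun i => assignFresh g r (.fresh i.val)) ↔ smallExtent ρ q r :=
  iff_of_eq (congrArg (ρ (.small q)) (funext fun i => assignFresh_fresh r i))

variable [PrecomputedOrder Sym]

theorem sat_star_pred {q : PredSym Sym} {t : Fin q.arity → GTerm Sym Var} :
    ((Formula.pred q t).star p).Sat (interp v J) ρ g k ↔
      (⟨q, fun i => (t i).eval (interp v J) g k⟩ : PAtom Sym) ∈
        overlay p (smallExtent ρ) J := by
  by_cases hq : q ∈ p
  · rw [mem_overlay_of_mem hq]
    simp only [Formula.star, hq, if_true]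
    rfl
  · rw [mem_overlay_of_notMem hq]
    simp only [Formula.star, hq, if_false]
    rfl

theorem sat_freshAtom {a : Atom Sym Var} {r : Fin a.pred.arity → PTerm Sym} :
    (freshAtom a).Sat (interp v J) ρ (assignFresh g r) k ↔ (⟨a.pred, r⟩ : PAtom Sym) ∈ J := by
  simp only [freshAtom, Formula.Sat, GTerm.eval, assignFresh_fresh]
  rfl

theorem sat_star_freshAtom {a : Atom Sym Var} {r : Fin a.pred.arity → PTerm Sym} :
    ((freshAtom a).star p).Sat (interp v J) ρ (assignFresh g r) k ↔
      (⟨a.pred, r⟩ : PAtom Sym) ∈ overlay p (smallExtent ρ) J := by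
  rw [freshAtom, sat_star_pred]
  simp only [GTerm.eval, assignFresh_fresh]

/-- The ground atom obtained by applying a valuation and an assignment. -/
noncomputable def Atom.ground (v : Ω.Valuation) (s : Var → PTerm Sym) (a : Atom Sym Var) :
    Atom Sym Empty :=
  a.replace (fun c => (v.apply c).toTerm) (fun x => (s x).toTerm)

/-- The ground rule obtained by applying a valuation and an assignment. -/
noncomputable def Rule.ground (v : Ω.Valuation) (s : Var → PTerm Sym) (R : Rule Sym Var) :
    Rule Sym Empty :=
  R.replace (fun c => (v.apply c).toTerm) (fun x => (s x).toTerm)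

theorem sat_star_valArgs {a : Atom Sym Var} {r : Fin a.pred.arity → PTerm Sym} :
    ((valArgs a).star p).Sat (interp v J) ρ (assignFresh g r) k ↔
      r ∈ (a.ground v fun x => g (.prog x)).values := by
  refine Iff.trans ?_ (Atom.mem_values (a := a.ground v fun x => g (.prog x))).symm
  rw [valArgs, Formula.sat_star_conj]
  simp only [List.mem_map, List.mem_finRange, true_and, forall_exists_index,
    forall_apply_eq_imp_iff]
  refine forall_congr' fun j => ?_
  rw [sat_star_val _ fun _ _ => rfl]
  simp only [GTerm.eval, assignFresh_fresh, assignFresh_prog]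
  rfl

/-- The negated literals match because `*` and here-and-there treat implication alike: each adds the
classical implication, evaluated in `J`, to the one evaluated "here". -/
theorem sat_star_tauB {b : BodyElt Sym Var} :
    ((tauB b).star p).Sat (interp v J) ρ g k ↔
      (tauBody (b.replace (fun c => (v.apply c).toTerm) fun x => (g (.prog x)).toTerm)).HSat
        (overlay p (smallExtent ρ) J) J := by
  cases b with
  | pos a =>
    rw [BodyElt.replace, hSat_tauBody_pos, tauB, Formula.star_exGs, Formula.sat_exGs_freshVars]
    refine exists_congr fun r => ?_
    simp only [Formula.star, Formula.Sat, sat_star_valArgs, sat_star_freshAtom]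
    rfl
  | neg a =>
    rw [BodyElt.replace, hSat_tauBody_neg, tauB, Formula.star_exGs, Formula.sat_exGs_freshVars]
    refine exists_congr fun r => ?_
    simp only [Formula.star, Formula.Sat, Formula.neg, sat_star_valArgs, sat_star_freshAtom,
      sat_freshAtom]
    rfl
  | negneg a =>
    rw [BodyElt.replace, hSat_tauBody_negneg, tauB, Formula.star_exGs, Formula.sat_exGs_freshVars]
    refine exists_congr fun r => ?_
    simp only [Formula.star, Formula.Sat, Formula.neg, sat_star_valArgs, sat_star_freshAtom,
      sat_freshAtom]
    refine and_congr Iff.rfl (and_congr Iff.rfl ?_)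
    exact not_not
  | comp c t₁ t₂ =>
    rw [BodyElt.replace, hSat_tauBody_comp]
    change ((Formula.exGs (Formula.freshVars 2) _).star p).Sat _ _ _ _ ↔ _
    rw [Formula.star_exGs, Formula.sat_exGs_freshVars]
    have h₀ : ∀ r : Fin 2 → PTerm Sym, assignFresh g r (.fresh 0) = r 0 :=
      fun r => assignFresh_fresh r 0
    have h₁ : ∀ r : Fin 2 → PTerm Sym, assignFresh g r (.fresh 1) = r 1 :=
      fun r => assignFresh_fresh r 1
    have hc : ∀ r : Fin 2 → PTerm Sym,
        (((match c with
          | .eq => .eq (.var (.fresh 0)) (.var (.fresh 1))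
          | .ineq c => .ineq c (.var (.fresh 0)) (.var (.fresh 1)) : Formula Sym Var).star
            p).Sat (interp v J) ρ (assignFresh g r) k) ↔ c.Holds (r 0) (r 1) := by
      intro r
      cases c <;> simp only [Formula.star, Formula.Sat, GTerm.eval, h₀, h₁] <;> rfl
    refine (exists_congr fun r => Formula.sat_star_conj).trans ?_
    simp only [List.forall_mem_cons, List.not_mem_nil, false_imp_iff, implies_true, and_true]
    have hv : ∀ (r : Fin 2 → PTerm Sym) (t : Term Sym Var) (j : ℕ),
        ((val t (.var (.fresh j)) 0).star p).Sat (interp v J) ρ (assignFresh g r) k ↔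
          assignFresh g r (.fresh j) ∈ (t.ground v fun x => g (.prog x)).values :=
      fun r t j => sat_star_val t fun _ _ => rfl
    simp only [hv, h₀, h₁]
    constructor
    · rintro ⟨r, H₀, H₁, H⟩
      exact ⟨_, H₀, _, H₁, (hc r).1 H⟩
    · rintro ⟨r₀, H₀, r₁, H₁, H⟩
      exact ⟨![r₀, r₁], H₀, H₁, (hc _).2 H⟩

theorem sat_valArgs {a : Atom Sym Var} {r : Fin a.pred.arity → PTerm Sym} :
    (valArgs a).Sat (interp v J) ρ (assignFresh g r) k ↔
      r ∈ (a.ground v fun x => g (.prog x)).values :=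
  Formula.sat_star_nil.symm.trans sat_star_valArgs

theorem sat_tauB {b : BodyElt Sym Var} :
    (tauB b).Sat (interp v J) ρ g k ↔
      (tauBody (b.replace (fun c => (v.apply c).toTerm) fun x => (g (.prog x)).toTerm)).Sat J := by
  rw [← Formula.sat_star_nil, sat_star_tauB, overlay_nil, PForm.hSat_self]

/-- The formula `H*` guards the atom by an implication that `τ` does not have, so `*` produces an
additional classical conjunct. The inclusion `hJ` makes that conjunct a consequence of the starred
one. -/
theorem sat_star_tauStarHead (hJ : overlay p (smallExtent ρ) J ⊆ J) {H : Head Sym Var} :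
    ((tauStarHead H).star p).Sat (interp v J) ρ g k ↔
      (tauHead (H.replace (fun c => (v.apply c).toTerm) fun x => (g (.prog x)).toTerm)).HSat
        (overlay p (smallExtent ρ) J) J := by
  cases H with
  | basic a =>
    rw [Head.replace, hSat_tauHead_basic, tauStarHead, Formula.star_allGs,
      Formula.sat_allGs_freshVars]
    refine forall_congr' fun r => ?_
    simp only [Formula.star, Formula.Sat, sat_star_valArgs, sat_star_freshAtom, sat_valArgs,
      sat_freshAtom]
    exact ⟨And.left, fun H => ⟨H, fun hr => hJ (H hr)⟩⟩
  | choice a =>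
    rw [Head.replace, hSat_tauHead_choice, tauStarHead, Formula.star_allGs,
      Formula.sat_allGs_freshVars]
    refine forall_congr' fun r => ?_
    simp only [Formula.star, Formula.Sat, Formula.neg, sat_star_valArgs, sat_star_freshAtom,
      sat_valArgs, sat_freshAtom]
    exact ⟨And.left, fun H => ⟨H, fun hr => (H hr).imp (fun h => hJ h) And.right⟩⟩
  | empty => rfl

theorem sat_tauStarHead {H : Head Sym Var} :
    (tauStarHead H).Sat (interp v J) ρ g k ↔
      (tauHead (H.replace (fun c => (v.apply c).toTerm) fun x => (g (.prog x)).toTerm)).Sat J := by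
  rw [← Formula.sat_star_nil, sat_star_tauStarHead (by rw [overlay_nil]), overlay_nil,
    PForm.hSat_self]

theorem sat_star_tauStarRule (hJ : overlay p (smallExtent ρ) J ⊆ J) {R : Rule Sym Var} :
    ((tauStarRule R).star p).Sat (interp v J) ρ g k ↔
      ∀ s : Var → PTerm Sym, (tauRule (R.ground v s)).HSat (overlay p (smallExtent ρ) J) J := by
  have key : ∀ g : GVar Var → PTerm Sym,
      ((Formula.imp (.conj (R.body.map tauB)) (tauStarHead R.head)).star p).Sat
        (interp v J) ρ g k ↔
      (tauRule (R.ground v fun x => g (.prog x))).HSat (overlay p (smallExtent ρ) J) J := by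
    intro g
    -- The classical truth of the body is rewritten as satisfaction at `(J, J)`, so that
    -- `PForm.hSat_conj` splits it too; the next line returns to `Sat`.
    simp only [tauRule, PForm.HSat, Formula.star, Formula.Sat, sat_star_tauStarHead hJ,
      sat_tauStarHead, Formula.sat_star_conj, Formula.sat_conj, PForm.hSat_conj, Rule.ground,
      Rule.replace, List.forall_mem_map, sat_star_tauB, sat_tauB, ← PForm.hSat_self J (.conj _)]
    simp only [PForm.hSat_self]
  rw [tauStarRule, Formula.star_allGs, Formula.sat_allGs]
  simp only [key]
  constructor
  · intro H s
    classical
    -- The universal closure binds only the variables of `R`, so `s` is followed on these and `g`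
    -- elsewhere; the instance of `R` is the same.
    have := H (fun
      | .prog x => if x ∈ R.vars then s x else g (.prog x)
      | .fresh j => g (.fresh j)) (by
        rintro (x | j) hx
        · simp only [List.mem_map, GVar.prog.injEq, exists_eq_right] at hx
          simp [hx]
        · rfl)
    convert this using 2
    exact Rule.replace_congr fun x hx => by simp [hx]
  · exact fun H g' _ => H _

theorem sat_tauStarRule {R : Rule Sym Var} :
    (tauStarRule R).Sat (interp v J) ρ g k ↔
      ∀ s : Var → PTerm Sym, (tauRule (R.ground v s)).HSat J J := by
  rw [← Formula.sat_star_nil, sat_star_tauStarRule (by rw [overlay_nil]), overlay_nil]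

/-- Reading a private symbol as a predicate variable amounts to changing its extent in the
interpretation; terms are unaffected, since the interpretations differ only on predicate symbols. -/
theorem sat_hide {F : Formula Sym Var} :
    (F.hide h).Sat (interp v I) ρ g k ↔
      F.Sat (interp v (overlay h (bigExtent ρ) I)) ρ g k := by
  have hI : ∀ k : ℕ → ℤ, ∀ t : ITerm, t.eval (interp v I) k =
      t.eval (interp v (overlay h (bigExtent ρ) I)) k := by
    intro k t
    induction t with
    | num | var => rfl
    | _ t₁ t₂ h₁ h₂ => simp only [ITerm.eval, h₁, h₂]; rfl
  have hG : ∀ g : GVar Var → PTerm Sym, ∀ k : ℕ → ℤ, ∀ t : GTerm Sym Var,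
      t.eval (interp v I) g k = t.eval (interp v (overlay h (bigExtent ρ) I)) g k := by
    intro g k t
    cases t with
    | int t => simp only [GTerm.eval, hI]; rfl
    | _ => rfl
  induction F generalizing g k with
  | bot => rfl
  | pred q t =>
    have e : (Formula.pred q t).Sat (interp v (overlay h (bigExtent ρ) I)) ρ g k ↔
        (⟨q, fun i => (t i).eval (interp v I) g k⟩ : PAtom Sym) ∈ overlay h (bigExtent ρ) I := by
      simp only [Formula.Sat, hG]; rfl
    rw [e]
    by_cases hq : q ∈ h
    · rw [mem_overlay_of_mem hq]
      simp only [Formula.hide, hq, if_true]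
      rfl
    · rw [mem_overlay_of_notMem hq]
      simp only [Formula.hide, hq, if_false]
      rfl
  | pvar | eq => simp only [Formula.hide, Formula.Sat, hG]
  | ineq => simp only [Formula.hide, Formula.Sat, hG]; rfl
  | and F G hF hG | or F G hF hG | imp F G hF hG => simp only [Formula.hide, Formula.Sat, hF, hG]
  | allG x F hF | exG x F hF | allI x F hF | exI x F hF =>
    simp only [Formula.hide, Formula.Sat, hF]

theorem interp_pred_assignFresh {q : PredSym Sym} {r : Fin q.arity → PTerm Sym} :
    (interp v J).pred q (fun i => assignFresh g r (.fresh i.val)) ↔ (⟨q, r⟩ : PAtom Sym) ∈ J :=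
  iff_of_eq (congrArg ((interp v J).pred q) (funext fun i => assignFresh_fresh r i))

/-- The overlay differs from `J` at most on members of `p`, so comparing `u` with `p` is comparing
the two sets of atoms. -/
theorem sat_smallLe : (Formula.smallLe p : Formula Sym Var).Sat (interp v J) ρ g k ↔
    overlay p (smallExtent ρ) J ⊆ J := by
  simp only [Formula.smallLe, Formula.sat_conj, List.forall_mem_map, Formula.sat_allGs_freshVars]
  constructor
  · rintro H ⟨q, r⟩ ha
    by_cases hq : q ∈ p
    · exact interp_pred_assignFresh.1
        (H q hq r (smallExtent_assignFresh.2 ((mem_overlay_of_mem hq).1 ha)))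
    · exact (mem_overlay_of_notMem hq).1 ha
  · intro H q hq r hr
    exact interp_pred_assignFresh.2
      (H ((mem_overlay_of_mem hq).2 (smallExtent_assignFresh.1 hr)))

theorem sat_leSmall : (Formula.leSmall p : Formula Sym Var).Sat (interp v J) ρ g k ↔
    J ⊆ overlay p (smallExtent ρ) J := by
  simp only [Formula.leSmall, Formula.sat_conj, List.forall_mem_map, Formula.sat_allGs_freshVars]
  constructor
  · rintro H ⟨q, r⟩ ha
    by_cases hq : q ∈ p
    · exact (mem_overlay_of_mem hq).2
        (smallExtent_assignFresh.1 (H q hq r (interp_pred_assignFresh.2 ha)))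
    · exact (mem_overlay_of_notMem hq).2 ha
  · intro H q hq r hr
    exact smallExtent_assignFresh.2
      ((mem_overlay_of_mem hq).1 (H (interp_pred_assignFresh.1 hr)))

theorem sat_smallLt : (Formula.smallLt p : Formula Sym Var).Sat (interp v J) ρ g k ↔
    overlay p (smallExtent ρ) J ⊂ J := by
  simp only [Formula.smallLt, Formula.neg, Formula.Sat, sat_smallLe, sat_leSmall]
  rfl

/-- `J` satisfies all ground instances of the rules and no set obtained from `J` by shrinking
the extents of the members of `p` is a here-world of a model of these instances. -/
def IsStableRelativeTo (p : List (PredSym Sym)) (v : Ω.Valuation) (J : Set (PAtom Sym)) : Prop :=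
  (∀ R ∈ Ω.rules, ∀ s : Var → PTerm Sym, (tauRule (R.ground v s)).HSat J J) ∧
    ∀ Y ⊂ J, (∀ a : PAtom Sym, a.1 ∉ p → (a ∈ Y ↔ a ∈ J)) →
      ¬ ∀ R ∈ Ω.rules, ∀ s : Var → PTerm Sym, (tauRule (R.ground v s)).HSat Y J

/-- The quantified tuple `u` and the competitors `Y` determine each other: `Y` is the overlay by
`u`, and `u` consists of the extents in `Y` of the members of `p`. -/
theorem sat_hide_SM :
    ((SM p (.conj (tauStar Ω.rules))).hide h).Sat (interp v I) g k ρ ↔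
      IsStableRelativeTo p v (overlay h (bigExtent ρ) I) := by
  simp only [SM, SOFormula.hide, SOFormula.Sat, SOFormula.hide_exPs, SOFormula.sat_exPs,
    sat_hide, Formula.Sat, sat_smallLt, Formula.sat_star_conj, Formula.sat_conj, tauStar,
    List.forall_mem_map, Finset.mem_toList, sat_tauStarRule, IsStableRelativeTo]
  refine and_congr Iff.rfl ?_
  rw [not_exists]
  -- Quantifying over `u` leaves the variables for private symbols alone, so the "there" world stays
  -- fixed.
  have hbig : ∀ ρ' : (x : PredVar Sym) → (Fin x.arity → PTerm Sym) → Prop,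
      (∀ x ∉ p.map PredVar.small, ρ' x = ρ x) → bigExtent ρ' = bigExtent ρ :=
    fun ρ' H => funext fun q => H (.big q) (by simp)
  constructor
  · intro H Y hY hp hs
    classical
    let ρ' : (x : PredVar Sym) → (Fin x.arity → PTerm Sym) → Prop := fun
      | .small q => if q ∈ p then fun r => (⟨q, r⟩ : PAtom Sym) ∈ Y else ρ (.small q)
      | .big q => ρ (.big q)
    have hρ : ∀ x ∉ p.map PredVar.small, ρ' x = ρ x := by
      rintro (q | q) hx
      · have hq : q ∉ p := fun hq => hx (List.mem_map_of_mem hq)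
        simp [ρ', hq]
      · rfl
    have hY' : overlay p (smallExtent ρ') (overlay h (bigExtent ρ) I) = Y := by
      ext ⟨q, r⟩
      by_cases hq : q ∈ p
      · rw [mem_overlay_of_mem hq]
        simp [ρ', smallExtent, hq]
      · rw [mem_overlay_of_notMem hq, hp _ hq]
    refine H ρ' ⟨hρ, ?_⟩
    rw [hbig ρ' hρ, hY']
    refine ⟨hY, fun R hR => (sat_star_tauStarRule (hY' ▸ hY.le)).2 ?_⟩
    rw [hY']
    exact hs R hR
  · rintro H ρ' ⟨hρ, hlt, hs⟩
    rw [hbig ρ' hρ] at hlt hs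
    exact H _ hlt (fun a ha => mem_overlay_of_notMem ha)
      fun R hR => (sat_star_tauStarRule hlt.le).1 (hs R hR)

theorem isStableModelWithPrivate_iff :
    IsStableModelWithPrivate p h (tauStar Ω.rules) (interp v I) ↔
      ∃ J : Set (PAtom Sym), (∀ a : PAtom Sym, a.1 ∉ h → (a ∈ J ↔ a ∈ I)) ∧
        IsStableRelativeTo p v J := by
  simp only [IsStableModelWithPrivate, SOFormula.IsModel, SOFormula.sat_exPs, sat_hide_SM]
  constructor
  · intro H
    -- Arbitrary initial values: the condition reached does not mention object variables, and the
    -- predicate variables for `h` are bound.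
    obtain ⟨ρ, -, hs⟩ := H (fun _ _ => False) (fun _ => .inf) (fun _ => 0)
    exact ⟨_, fun a ha => mem_overlay_of_notMem ha, hs⟩
  · rintro ⟨J, hJ, hs⟩ ρ g k
    classical
    let ρ' : (x : PredVar Sym) → (Fin x.arity → PTerm Sym) → Prop := fun
      | .big q => if q ∈ h then fun r => (⟨q, r⟩ : PAtom Sym) ∈ J else ρ (.big q)
      | .small q => ρ (.small q)
    refine ⟨ρ', ?_, ?_⟩
    · rintro (q | q) hx
      · rfl
      · have hq : q ∉ h := fun hq => hx (List.mem_map_of_mem hq)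
        simp [ρ', hq]
    · convert hs
      ext ⟨q, r⟩
      by_cases hq : q ∈ h
      · rw [mem_overlay_of_mem hq]
        simp [ρ', bigExtent, hq]
      · rw [mem_overlay_of_notMem hq, hJ _ hq]

end RuleSemantics

/-! ### Stable models of an instantiated program. -/

section IOModels

variable {Sym Var : Type*} {Ω : IOProgram Sym Var} {v : Ω.Valuation}
  {i I Y J : Set (PAtom Sym)}

open IOProgram

theorem Head.preds_replace {Var' : Type*} (f : Sym → Term Sym Var') (s : Var → Term Sym Var')
    (H : Head Sym Var) : (H.replace f s).preds = H.preds := by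
  cases H <;> rfl

theorem mem_privateSyms {q : PredSym Sym} :
    q ∈ Ω.privateSyms ↔ q ∈ Ω.occurring ∧ q ∉ Ω.publicSyms := by
  simp [privateSyms]

theorem mem_intensionalSyms {q : PredSym Sym} :
    q ∈ Ω.intensionalSyms ↔ q ∈ Ω.occurring ∧ q ∉ Ω.input := by
  simp [intensionalSyms]

theorem mem_publicSyms {q : PredSym Sym} : q ∈ Ω.publicSyms ↔ q ∈ Ω.input ∨ q ∈ Ω.output := by
  simp [publicSyms]

theorem mem_occurring_of_mem_head_preds {R : Rule Sym Var} (hR : R ∈ Ω.rules) {q : PredSym Sym}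
    (hq : q ∈ R.head.preds) : q ∈ Ω.occurring := by
  simp only [occurring, Finset.mem_biUnion, List.mem_toFinset, Rule.preds, List.mem_append]
  exact ⟨R, hR, .inl hq⟩

variable [PrecomputedOrder Sym]

theorem hSat_tauRule_fact {a : PAtom Sym} {s : Var → PTerm Sym} (hYJ : Y ⊆ J) :
    (tauRule ((fact a : Rule Sym Var).inst s)).HSat Y J ↔ a ∈ Y := by
  have e : (fact a : Rule Sym Var).inst s = ⟨.basic ⟨a.1, fun j => (a.2 j).toTerm⟩, []⟩ := by
    simp only [fact, Rule.inst, Rule.replace, Head.replace, Atom.replace,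
      PTerm.replace_toTerm_sym, List.map_nil]
  have hv : ∀ r : Fin a.1.arity → PTerm Sym,
      r ∈ Atom.values (⟨a.1, fun j => (a.2 j).toTerm⟩ : Atom Sym Empty) ↔ r = a.2 := by
    intro r
    refine Atom.mem_values.trans ?_
    simp only [PTerm.values_toTerm, Finset.mem_singleton, funext_iff]
  have hh : (tauHead (.basic (⟨a.1, fun j => (a.2 j).toTerm⟩ : Atom Sym Empty))).HSat Y J ↔
      a ∈ Y := by
    rw [hSat_tauHead_basic]
    refine ⟨fun H => H a.2 ((hv _).2 rfl), fun H r hr => ?_⟩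
    obtain rfl := (hv r).1 hr
    exact H
  rw [e, ← hh]
  constructor
  · exact fun H => H.1 (PForm.hSat_conj.2 (by simp))
  · exact fun H => ⟨fun _ => H, fun _ => H.sat hYJ⟩

theorem hSat_tau_instantiate (hYJ : Y ⊆ J) :
    (∀ F ∈ tau (Ω.instantiate v i), F.HSat Y J) ↔
      (∀ R ∈ Ω.rules, ∀ s : Var → PTerm Sym, (tauRule (R.ground v s)).HSat Y J) ∧ i ⊆ Y := by
  constructor
  · intro H
    refine ⟨fun R hR s => ?_, fun a ha => ?_⟩
    · have := H _ ⟨_, .inl ⟨R, hR, rfl⟩, s, rfl⟩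
      rwa [Rule.inst, Rule.replace_replace] at this
    -- A fact has no variables, so any substitution will do.
    · exact (hSat_tauRule_fact hYJ).1 (H _ ⟨_, .inr ⟨a, ha, rfl⟩, fun _ => .inf, rfl⟩)
  · rintro ⟨H₁, H₂⟩ F ⟨_, (⟨R, hR, rfl⟩ | ⟨a, ha, rfl⟩), s, rfl⟩
    · rw [Rule.inst, Rule.replace_replace]
      exact H₁ R hR s
    · exact (hSat_tauRule_fact hYJ).2 (H₂ ha)

theorem isStableModelOf_instantiate_iff :
    IsStableModelOf (Ω.instantiate v i) J ↔
      ((∀ R ∈ Ω.rules, ∀ s : Var → PTerm Sym, (tauRule (R.ground v s)).HSat J J) ∧ i ⊆ J) ∧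
      ∀ Y ⊆ J, (∀ R ∈ Ω.rules, ∀ s : Var → PTerm Sym, (tauRule (R.ground v s)).HSat Y J) →
        i ⊆ Y → Y = J := by
  rw [IsStableModelOf, PForm.isStableModel_iff, hSat_tau_instantiate subset_rfl]
  refine and_congr Iff.rfl (forall₂_congr fun Y hY => ?_)
  rw [hSat_tau_instantiate hY, and_imp]

/-- In a stable model of an instantiated program, every atom is a fact of the input or begins
with a symbol that occurs in the head of a rule. -/
theorem mem_or_mem_head_preds (hJ : IsStableModelOf (Ω.instantiate v i) J) {a : PAtom Sym}
    (ha : a ∈ J) : a ∈ i ∨ ∃ R ∈ Ω.rules, a.1 ∈ R.head.preds := by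
  obtain ⟨⟨hs, hiJ⟩, hmin⟩ := isStableModelOf_instantiate_iff.1 hJ
  -- Deleting all unsupported atoms leaves the extents of head symbols unchanged, so every rule
  -- remains satisfied; by minimality nothing was deleted.
  have hYJ : {b ∈ J | b ∈ i ∨ ∃ R ∈ Ω.rules, b.1 ∈ R.head.preds} ⊆ J := fun b hb => hb.1
  have e := hmin _ hYJ (fun R hR s => hSat_tauRule_of_head_congr hYJ (fun q hq r => ?_) (hs R hR s))
    fun b hb => ⟨hiJ hb, .inl hb⟩
  · exact (e.symm ▸ ha : a ∈ {b ∈ J | b ∈ i ∨ ∃ R ∈ Ω.rules, b.1 ∈ R.head.preds}).2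
  · rw [Rule.ground, Rule.replace, Head.preds_replace] at hq
    exact ⟨fun h => h.1, fun h => ⟨h, .inr ⟨R, hR, hq⟩⟩⟩

end IOModels

end AspIO

/-! ### Matching the two classes of competitors. -/

theorem mainTheorem4 {Sym Var : Type*} [AspIO.PrecomputedOrder Sym]
    (Ω : AspIO.IOProgram Sym Var) (v : Ω.Valuation) (i : Set (AspIO.PAtom Sym))
    (hi : Ω.IsInputSet i) (I : Set (AspIO.PAtom Sym))
    (hI : ∀ a ∈ I, a.1 ∈ Ω.publicSyms)
    (hOut : ∀ a ∈ I, a.1 ∈ Ω.output → a.1 ∈ Ω.occurring) :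
    Ω.IsIOModel v i I ↔
      AspIO.IsStableModelWithPrivate Ω.intensionalSyms Ω.privateSyms
        (AspIO.tauStar Ω.rules) (AspIO.IOProgram.interp v I) ∧
      Ω.inputPart I = i := by
  open AspIO in
  rw [isStableModelWithPrivate_iff]
  constructor
  · rintro ⟨J, hJ, rfl⟩
    have hin : ∀ a ∈ J, a.1 ∈ Ω.input → a ∈ i := fun a ha h =>
      (mem_or_mem_head_preds hJ ha).resolve_right fun ⟨R, hR, hq⟩ =>
        Ω.input_not_in_heads R hR _ h hq
    have hocc : ∀ a ∈ J, a.1 ∈ Ω.publicSyms ∨ a.1 ∈ Ω.occurring := fun a ha =>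
      (mem_or_mem_head_preds hJ ha).imp (fun h => mem_publicSyms.2 (.inl (hi a h).1))
        fun ⟨R, hR, hq⟩ => mem_occurring_of_mem_head_preds hR hq
    obtain ⟨⟨hs, hiJ⟩, hmin⟩ := isStableModelOf_instantiate_iff.1 hJ
    have hpart : Ω.inputPart {a ∈ J | a.1 ∈ Ω.publicSyms} = i := by
      ext a
      exact ⟨fun h => hin a h.1.1 h.2, fun h =>
        ⟨⟨hiJ h, mem_publicSyms.2 (.inl (hi a h).1)⟩, (hi a h).1⟩⟩
    refine ⟨⟨J, fun a ha => ?_, hs, fun Y hY hp hYs => hY.ne (hmin Y hY.le hYs fun a ha => ?_)⟩,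
      hpart⟩
    · refine ⟨fun h => ⟨h, ?_⟩, fun h => h.1⟩
      -- An atom of `J` that is not public has an occurring symbol, hence a private one.
      by_contra hpub
      exact ha (mem_privateSyms.2 ⟨(hocc a h).resolve_left hpub, hpub⟩)
    -- Input symbols lie outside `p`, so `Y` agrees with `J` on them and contains `i`.
    · exact (hp a fun h => (mem_intensionalSyms.1 h).2 (hi a ha).1).2 (hiJ ha)
  · rintro ⟨⟨J, hJ, hs, hmin⟩, hpart⟩
    have hiI : i ⊆ I := hpart ▸ fun a h => h.1
    have hpub : ∀ a : PAtom Sym, a.1 ∈ Ω.publicSyms → (a ∈ J ↔ a ∈ I) :=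
      fun a ha => hJ a fun h => (mem_privateSyms.1 h).2 ha
    have hiJ : i ⊆ J := fun a ha => (hpub a (hI a (hiI ha))).2 (hiI ha)
    refine ⟨J, isStableModelOf_instantiate_iff.2 ⟨⟨hs, hiJ⟩, fun Y hY hYs hiY => ?_⟩, ?_⟩
    · by_contra hne
      -- It remains to see that `Y` keeps every atom `a` of `J` whose symbol is outside `p`; this is
      -- done by showing `a ∈ i`.
      refine hmin Y (hY.ssubset_of_ne hne) (fun a ha => ⟨fun h => hY h, fun haJ => ?_⟩) hYs
      -- Otherwise the symbol of `a` would be private, hence intensional.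
      have haI : a ∈ I := by
        by_contra haI
        have := mt (hJ a) (fun h => haI (h.1 haJ))
        rw [not_not, mem_privateSyms, mem_publicSyms, not_or] at this
        exact ha (mem_intensionalSyms.2 ⟨this.1, this.2.1⟩)
      refine hiY (hpart ▸ ⟨haI, ?_⟩)
      -- An output symbol is impossible here: by `hOut` it occurs in the rules, so it would be in
      -- `p` unless it is an input symbol.
      rcases mem_publicSyms.1 (hI a haI) with h | h
      · exact h
      · by_contra hin
        exact ha (mem_intensionalSyms.2 ⟨hOut a haI h, hin⟩)
    · ext a
      exact ⟨fun h => ⟨(hpub a (hI a h)).2 h, hI a h⟩, fun h => (hpub a h.2).1 h.1⟩
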